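/- A permutation of size $n\ge 1$ is a bijection $\sigma$ of $\{1,\dots,n\}$, written as the word $\sigma_1\cdots\sigma_n$. A permutation $\pi$ of size $k$ is a pattern of $\sigma$ if there are $i_1<\dots<i_k$ such that $\pi$ is order-isomorphic to $\sigma_{i_1}\cdots\sigma_{i_k}$; $Av(B)$ is the set of permutations that have no element of $B$ as a pattern. An interval of $\sigma$ is a factor $\sigma_a\sigma_{a+1}\cdots\sigma_b$ whose set of values is an interval of integers; $\sigma$ is simple if its only intervals are the singletons and the whole permutation. For $m\ge 2$ the exceptional permutations of size $2m$ are (type 1) $2\,4\,6\cdots(2m)\,1\,3\,5\cdots(2m-1)$, (type 2) $(2m-1)\,(2m-3)\cdots 1\,(2m)\,(2m-2)\cdots 2$, (type 3) $(m+1)\,1\,(m+2)\,2\cdots(2m)\,m$, (type 4) $m\,(2m)\,(m-1)\,(2m-1)\cdots 1\,(m+1)$. Let $B$ be a finite set of simple permutations containing none of $1$, $12$, $21$. Consider the following algorithm. 1. Set $Si_1=\{1\}$, $Si_2=\{12,21\}$, $Si_3=\emptyset$, $Si_4=\{2413,3142\}\setminus B$ and $n=5$. 2. While $Si_{n-1}\neq\emptyset$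 or $Si_{n-2}\neq\emptyset$, do the following. (a) Set $Si_n=\emptyset$. (b) For each $\pi\in Si_{n-1}$ and each way to insert a point into $\pi$ such that the resulting permutation $\sigma$ of size $n$ is simple: if $\sigma\notin B$, compute the $n$ permutations $\tau$ obtained by deleting one point of $\sigma$ (and renormalizing); if each of these $\tau$ that is simple belongs to $Si_{n-1}$, add $\sigma$ to $Si_n$. (c) For each $\pi\in Si_{n-2}$ and each type $i\in\{1,2,3,4\}$ such that $\pi$ is exceptional of type $i$: if the exceptional permutation $\sigma$ of type $i$ and size $n$ is not in $B$, add $\sigma$ to $Si_n$. (d) Replace $n$ by $n+1$. Theorem. For every $n\ge 1$ such that the algorithm computes $Si_n$, the set $Si_n$ is exactly the set of simple permutations of size $n$ contained in $Av(B)$. Every $Si_n$, $n\ge 1$, is computed, unless the algorithm terminates before computing it, in which case $Av(B)$ contains no simple permutation of size $n$ (so that the statement holds for each $n\ge 1$ with the convention that $Si_n=\emptyset$ if it is never computed). Moreover the algorithm performs no pattern-involvement test (a test of whether a given permutation is a pattern of another given one). -/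

import Mathlib

namespace SimplePerm

/-! ## Permutations, patterns, simple permutations

A permutation of size `n` is an element of `Equiv.Perm (Fin n)`; positions and values are numbered
from `0`, so the word `σ₁ σ₂ … σₙ` has `σⱼ = σ (j - 1) + 1`. -/

/-- `π` is a pattern of `σ`: some subsequence of the word of `σ` is order-isomorphic to `π`. -/
def IsPattern {k n : ℕ} (π : Equiv.Perm (Fin k)) (σ : Equiv.Perm (Fin n)) : Prop :=
  ∃ f : Fin k ↪o Fin n, ∀ i j : Fin k, π i < π j ↔ σ (f i) < σ (f j)

/-- The class `Av(B)` of all permutations (of all sizes `n ≥ 1`) having no element of `B` as a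
pattern. -/
def Av (B : Set (Σ n : ℕ, Equiv.Perm (Fin n))) : Set (Σ n : ℕ, Equiv.Perm (Fin n)) :=
  {σ | 1 ≤ σ.1 ∧ ∀ β ∈ B, ¬ IsPattern β.2 σ.2}

/-- The positions `a, …, b` form an interval of `σ`: their set of values is an interval. -/
def IsInterval {n : ℕ} (σ : Equiv.Perm (Fin n)) (a b : Fin n) : Prop :=
  a ≤ b ∧ ∃ c d : Fin n, (Finset.Icc a b).image σ = Finset.Icc c d

/-- `σ` is simple: its size is at least `1` and its only intervals are the singletons and the
whole permutation. -/
def IsSimple {n : ℕ} (σ : Equiv.Perm (Fin n)) : Prop :=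
  1 ≤ n ∧ ∀ a b : Fin n, IsInterval σ a b → a = b ∨ Finset.Icc a b = Finset.univ

/-- The permutation `12`. -/
def perm12 : Equiv.Perm (Fin 2) := 1

/-- The permutation `21`. -/
def perm21 : Equiv.Perm (Fin 2) := Equiv.swap 0 1

/-- The permutation `2413`. -/
def perm2413 : Equiv.Perm (Fin 4) :=
  ⟨![1, 3, 0, 2], ![2, 0, 3, 1], by decide, by decide⟩

/-- The permutation `3142`. -/
def perm3142 : Equiv.Perm (Fin 4) :=
  ⟨![2, 0, 3, 1], ![1, 3, 0, 2], by decide, by decide⟩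

/-! ## Exceptional permutations -/

/-- The four types of exceptional permutations. -/
inductive ExcType where
  | one
  | two
  | three
  | four

/-- The value (from `0`) at position `j` (from `0`) of the exceptional permutation of size `2 m`:
* type 1: `2 4 6 … (2m) 1 3 5 … (2m-1)`;
* type 2: `(2m-1) (2m-3) … 1 (2m) (2m-2) … 2`;
* type 3: `(m+1) 1 (m+2) 2 … (2m) m`;
* type 4: `m (2m) (m-1) (2m-1) … 1 (m+1)`. -/
def excValue (t : ExcType) (m j : ℕ) : ℕ :=
  match t with
  | .one => if j < m then 2 * j + 1 else 2 * (j - m)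
  | .two => if j < m then 2 * (m - 1 - j) else 2 * (2 * m - 1 - j) + 1
  | .three => if j % 2 = 0 then m + j / 2 else j / 2
  | .four => if j % 2 = 0 then m - 1 - j / 2 else 2 * m - 1 - j / 2

/-- The position of a given value in the exceptional permutation of size `2 m`. -/
def excPosition (t : ExcType) (m v : ℕ) : ℕ :=
  match t with
  | .one => if v % 2 = 0 then m + v / 2 else v / 2
  | .two => if v % 2 = 0 then m - 1 - v / 2 else 2 * m - 1 - v / 2
  | .three => if v < m then 2 * v + 1 else 2 * (v - m)
  | .four => if v < m then 2 * (m - 1 - v) else 2 * (2 * m - 1 - v) + 1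

theorem excValue_lt (t : ExcType) (m j : ℕ) (hj : j < 2 * m) : excValue t m j < 2 * m := by
  cases t <;> simp only [excValue] <;> split <;> omega

theorem excPosition_lt (t : ExcType) (m v : ℕ) (hv : v < 2 * m) :
    excPosition t m v < 2 * m := by
  cases t <;> simp only [excPosition] <;> split <;> omega

theorem excPosition_excValue (t : ExcType) (m j : ℕ) (hj : j < 2 * m) :
    excPosition t m (excValue t m j) = j := by
  cases t <;> simp only [excPosition, excValue] <;> split <;> split <;> omega

theorem excValue_excPosition (t : ExcType) (m v : ℕ) (hv : v < 2 * m) :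
    excValue t m (excPosition t m v) = v := by
  cases t <;> simp only [excPosition, excValue] <;> split <;> split <;> omega

/-- For even `n ≥ 4`, the exceptional permutation of type `t` and size `n` (there is none for other
`n`: for odd `n` the value is a placeholder). -/
def exceptional (t : ExcType) (n : ℕ) : Equiv.Perm (Fin n) :=
  if h : n = 2 * (n / 2) then
    { toFun := fun j => ⟨excValue t (n / 2) j, by
        have := excValue_lt t (n / 2) j (by omega); omega⟩
      invFun := fun v => ⟨excPosition t (n / 2) v, by
        have := excPosition_lt t (n / 2) v (by omega); omega⟩
      left_inv := fun j => Fin.ext (excPosition_excValue t (n / 2) j (by omega))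
      right_inv := fun v => Fin.ext (excValue_excPosition t (n / 2) v (by omega)) }
  else 1

/-- `σ` is exceptional of type `t`. -/
def IsExceptional (t : ExcType) {n : ℕ} (σ : Equiv.Perm (Fin n)) : Prop :=
  4 ≤ n ∧ n % 2 = 0 ∧ σ = exceptional t n

/-! ## Insertion and deletion of a point -/

/-- Insert into `π` a point at position `i` with value `v`, shifting the later positions and the
values from `v` on. -/
def insertPoint {n : ℕ} (π : Equiv.Perm (Fin n)) (i v : Fin (n + 1)) :
    Equiv.Perm (Fin (n + 1)) :=
  ((finSuccEquiv' i).trans (Equiv.optionCongr π)).trans (finSuccEquiv' v).symm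

/-- Delete from `σ` the point at position `i` and renormalize. -/
def deletePoint {n : ℕ} (σ : Equiv.Perm (Fin (n + 1))) (i : Fin (n + 1)) :
    Equiv.Perm (Fin n) :=
  Equiv.removeNone (((finSuccEquiv' i).symm.trans σ).trans (finSuccEquiv' (σ i)))

theorem insertPoint_self {n : ℕ} (π : Equiv.Perm (Fin n)) (i v : Fin (n + 1)) :
    insertPoint π i v i = v := by
  simp [insertPoint, finSuccEquiv'_at]

theorem insertPoint_succAbove {n : ℕ} (π : Equiv.Perm (Fin n)) (i v : Fin (n + 1)) (j : Fin n) :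
    insertPoint π i v (i.succAbove j) = v.succAbove (π j) := by
  simp [insertPoint, finSuccEquiv'_succAbove]

theorem succAbove_deletePoint {n : ℕ} (σ : Equiv.Perm (Fin (n + 1))) (i : Fin (n + 1))
    (j : Fin n) : (σ i).succAbove (deletePoint σ i j) = σ (i.succAbove j) := by
  set e := ((finSuccEquiv' i).symm.trans σ).trans (finSuccEquiv' (σ i)) with he
  have hj : ∃ x, e (some j) = some x := by
    refine Option.ne_none_iff_exists'.mp fun h => ?_
    simp [he, finSuccEquiv'_eq_none] at h
  have h : some (deletePoint σ i j) = e (some j) := Equiv.removeNone_some e hj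
  rw [← finSuccEquiv'_symm_some, h]
  simp [he]

/-! ## Programs that ask tests

Programs know nothing about the basis `B` except the answers to the tests they ask; all the tests
asked during an execution are recorded. -/

/-- The tests that a program may ask. -/
inductive Test where
  /-- Is `σ` simple? -/
  | simple {n : ℕ} (σ : Equiv.Perm (Fin n))
  /-- Is `σ` exceptional of type `t`? -/
  | exceptional (t : ExcType) {n : ℕ} (σ : Equiv.Perm (Fin n))
  /-- Is `σ` an element of the set listed by `S`? -/
  | mem {n : ℕ} (σ : Equiv.Perm (Fin n)) (S : List (Equiv.Perm (Fin n)))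
  /-- Is `σ` an element of the basis? -/
  | memBasis {n : ℕ} (σ : Equiv.Perm (Fin n))
  /-- Pattern-involvement test: is `π` a pattern of `σ`? -/
  | involves {k n : ℕ} (π : Equiv.Perm (Fin k)) (σ : Equiv.Perm (Fin n))

/-- The true answer to a test, for the basis `B`. -/
def Test.Holds (B : Set (Σ n : ℕ, Equiv.Perm (Fin n))) : Test → Prop
  | .simple σ => IsSimple σ
  | .exceptional t σ => IsExceptional t σ
  | .mem σ S => σ ∈ S
  | @Test.memBasis n σ => (⟨n, σ⟩ : Σ n : ℕ, Equiv.Perm (Fin n)) ∈ B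
  | .involves π σ => IsPattern π σ

/-- The test is a pattern-involvement test. -/
def Test.IsInvolvement : Test → Prop
  | .involves _ _ => True
  | _ => False

/-- A program with result in `α`: either it returns a value, or it asks a test and continues
according to the answer. -/
inductive Prog (α : Type) : Type where
  | ret (a : α) : Prog α
  | ask (t : Test) (next : Bool → Prog α) : Prog α

/-- Sequential composition. -/
def Prog.andThen {α β : Type} : Prog α → (α → Prog β) → Prog β
  | .ret a, f => f a
  | .ask t next, f => .ask t fun b => (next b).andThen f

instance : Monad Prog where
  pure := Prog.ret
  bind := Prog.andThen

/-- The program that asks the test `t` and returns the answer. -/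
def test (t : Test) : Prog Bool := .ask t .ret

/-- Execution of a program when the answers to the tests are given by `answer`: the returned value
and the list of all tests asked, in order. -/
def Prog.exec {α : Type} (answer : Test → Bool) : Prog α → α × List Test
  | .ret a => (a, [])
  | .ask t next =>
    let r := (next (answer t)).exec answer
    (r.1, t :: r.2)

open Classical in
/-- Execution of a program for the basis `B`: all tests are answered truthfully. -/
noncomputable def Prog.run {α : Type} (B : Set (Σ n : ℕ, Equiv.Perm (Fin n))) (p : Prog α) :
    α × List Test :=
  p.exec fun t => decide (t.Holds B)

/-! ## The algorithm -/

/-- The variables of the algorithm: the counter `n`, stored as `m = n - 2`, and the array of the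
sets `Si k`, stored as lists. -/
structure State where
  m : ℕ
  Si : (k : ℕ) → List (Equiv.Perm (Fin k))

/-- The value of the counter: the sets `Si 1, …, Si (n - 1)` have been computed. -/
def State.n (s : State) : ℕ := s.m + 2

/-- The condition of the while loop: `Si (n - 1) ≠ ∅` or `Si (n - 2) ≠ ∅`. -/
def State.loopCondition (s : State) : Prop := s.Si (s.m + 1) ≠ [] ∨ s.Si s.m ≠ []

instance (s : State) : Decidable s.loopCondition := by
  unfold State.loopCondition; infer_instance

/-- `Si 1 ← {1}`, `Si 2 ← {12, 21}`, `Si 3 ← ∅`, `Si 4 ← {2413, 3142} \ B`, `n ← 5`. -/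
def initialState : Prog State := do
  let Si4 ← [perm2413, perm3142].foldlM (init := []) fun S σ => do
    if ← test (.memBasis σ) then pure S else pure (S.insert σ)
  pure
    { m := 3
      Si := fun
        | 1 => [1]
        | 2 => [perm12, perm21]
        | 4 => Si4
        | _ => [] }

/-- The innermost loop: for each of the `n = m + 2` ways to delete a point in `σ`, if the resulting
permutation `τ` is simple and is not in `prev = Si (n - 1)`, the flag `inS` becomes `false`. -/
def deletionsOk {m : ℕ} (prev : List (Equiv.Perm (Fin (m + 1)))) (σ : Equiv.Perm (Fin (m + 2))) :
    Prog Bool :=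
  (List.finRange (m + 2)).foldlM (init := true) fun inS i => do
    let τ := deletePoint σ i
    if ← test (.simple τ) then
      if ← test (.mem τ prev) then pure inS else pure false
    else pure inS

/-- Treatment of a candidate `σ` for `Si n`, `acc` being the current value of `Si n`: if `σ ∉ B`
and the innermost loop leaves the flag at `true`, add `σ`. -/
def tryCandidate {m : ℕ} (prev : List (Equiv.Perm (Fin (m + 1))))
    (acc : List (Equiv.Perm (Fin (m + 2)))) (σ : Equiv.Perm (Fin (m + 2))) :
    Prog (List (Equiv.Perm (Fin (m + 2)))) := do
  if ← test (.memBasis σ) then pure acc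
  else
    if ← deletionsOk prev σ then pure (acc.insert σ) else pure acc

/-- First half of a pass of the while loop: for each `π` in `prev = Si (n - 1)` and each way to
insert a point into `π` such that the resulting permutation `σ` is simple, treat `σ`. -/
def insertionPhase {m : ℕ} (prev : List (Equiv.Perm (Fin (m + 1))))
    (acc : List (Equiv.Perm (Fin (m + 2)))) : Prog (List (Equiv.Perm (Fin (m + 2)))) :=
  prev.foldlM (init := acc) fun acc π =>
    (List.finRange (m + 2)).foldlM (init := acc) fun acc i =>
      (List.finRange (m + 2)).foldlM (init := acc) fun acc v => do
        let σ := insertPoint π i v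
        if ← test (.simple σ) then tryCandidate prev acc σ else pure acc

/-- Second half of a pass: for each `π` in `prev₂ = Si (n - 2)` which is exceptional of type `t`, if
the exceptional permutation of type `t` and size `n` is not in `B`, add it to `Si n`. -/
def exceptionalPhase {m : ℕ} (prev₂ : List (Equiv.Perm (Fin m)))
    (acc : List (Equiv.Perm (Fin (m + 2)))) : Prog (List (Equiv.Perm (Fin (m + 2)))) :=
  prev₂.foldlM (init := acc) fun acc π =>
    [ExcType.one, .two, .three, .four].foldlM (init := acc) fun acc t => do
      if ← test (.exceptional t π) then
        let σ := exceptional t (m + 2)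
        if ← test (.memBasis σ) then pure acc else pure (acc.insert σ)
      else pure acc

/-- The body of the while loop: compute `Si n` and increment `n`. -/
def loopBody (s : State) : Prog State := do
  let S₁ ← insertionPhase (s.Si (s.m + 1)) []
  let S₂ ← exceptionalPhase (s.Si s.m) S₁
  pure { m := s.m + 1, Si := Function.update s.Si (s.m + 2) S₂ }

/-- The algorithm, stopped after at most `passes` passes of the while loop; once the loop condition
fails, the algorithm has terminated and nothing changes any more. -/
def algorithm : (passes : ℕ) → Prog State
  | 0 => initialState
  | passes + 1 => do
    let s ← algorithm passes
    if s.loopCondition then loopBody s else pure s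

/-- The state of the algorithm with input `B` after at most `passes` passes of the loop. -/
noncomputable def stateAfter (B : Set (Σ n : ℕ, Equiv.Perm (Fin n))) (passes : ℕ) : State :=
  ((algorithm passes).run B).1

/-- The tests asked by the algorithm with input `B` during the initialization and the first
`passes` passes of the loop. -/
noncomputable def testsAsked (B : Set (Σ n : ℕ, Equiv.Perm (Fin n))) (passes : ℕ) : List Test :=
  ((algorithm passes).run B).2

end SimplePerm

/-! Two facts carry the proof. (1) If a simple permutation that is not exceptional properly contains
a simple `π` of size at least 4, then one of its one-point deletions is simple and still contains
`π` (`exists_simpleOn_compl_singleton`). (2) A simple proper pattern of size at least 3 of an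
exceptional permutation is a pattern of the exceptional permutation of the same type with two points
fewer (`isPattern_exceptional`). Hence, from size 4 on, an exceptional permutation has no simple
one-point deletion.

Soundness: a simple `σ` obtained by insertion has a simple one-point deletion, so it is not
exceptional. If `σ ∉ B` contained some `β ∈ B`, by (1) a simple one-point deletion would contain
`β`; but the simple deletions of an accepted candidate lie in the preceding set, hence in `Av B`.
For exceptional candidates (2) replaces (1). Completeness: a simple permutation of size at least 3
contains 2413 or 3142 (`isPattern_four_of_simpleOn`). By (1), from size 5 on, a non-exceptional one
therefore has a simple one-point deletion and is reached by insertion; an exceptional one is reached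
from its predecessor. With two consecutive empty sets nothing can be reached any more, which
justifies termination.

For (1), intervals are replaced by modules, sets that no outside point separates by position or by
value; these make sense for restrictions to arbitrary sets of positions. An occurrence of `π` grows
to all of `σ` by steps of one or two points that keep simplicity, so deleting some one or two points
leaves a simple permutation containing `π`. If one point never suffices, each of the two points, put
back, is either seen alike by the rest or the twin of a third point. Both cannot be of the first
kind, and a pair of twins propagates to a chain through all positions (or all values), which forces
`σ` to be exceptional.

The absence of involvement tests is checked compositionally on the programs. -/

namespace SimplePerm

/-! ## Modules -/

/-- The point at position `x` separates the points at positions `y` and `z` neither by position nor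
by value. -/
def Alike {n : ℕ} (σ : Equiv.Perm (Fin n)) (x y z : Fin n) : Prop :=
  (x < y ↔ x < z) ∧ (σ x < σ y ↔ σ x < σ z)

/-- `M` is a module of the restriction of `σ` to the positions in `S`. -/
def IsModuleOn {n : ℕ} (σ : Equiv.Perm (Fin n)) (S M : Set (Fin n)) : Prop :=
  M ⊆ S ∧ ∀ x ∈ S, x ∉ M → ∀ y ∈ M, ∀ z ∈ M, Alike σ x y z

/-- The restriction of `σ` to the positions in `S` has only trivial modules. -/
def SimpleOn {n : ℕ} (σ : Equiv.Perm (Fin n)) (S : Set (Fin n)) : Prop :=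
  ∀ M, IsModuleOn σ S M → M.Subsingleton ∨ M = S

section Alike

variable {n : ℕ} {σ : Equiv.Perm (Fin n)} {x y z u v : Fin n}

theorem Alike.refl (σ : Equiv.Perm (Fin n)) (x y : Fin n) : Alike σ x y y := ⟨Iff.rfl, Iff.rfl⟩

theorem Alike.symm (h : Alike σ x y z) : Alike σ x z y := ⟨h.1.symm, h.2.symm⟩

theorem Alike.trans (h : Alike σ x y z) (h' : Alike σ x z u) : Alike σ x y u :=
  ⟨h.1.trans h'.1, h.2.trans h'.2⟩

theorem lt_iff_not_lt_of_ne {α : Type*} [LinearOrder α] {a b : α} (h : a ≠ b) :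
    a < b ↔ ¬ b < a := by
  rw [not_lt]; exact ⟨le_of_lt, fun h' => lt_of_le_of_ne h' h⟩

/-- The relation of `y` to `x` is carried around the four points by alternately reversing a pair and
replacing one endpoint: `yx`, `xy`, `xv`, `vx`, `vu`, `uv`, `uy`, `yu`. -/
theorem Alike.square (h₁ : Alike σ x v y) (h₂ : Alike σ v x u) (h₃ : Alike σ u v y)
    (hxv : x ≠ v) (hxy : x ≠ y) (huv : u ≠ v) (huy : u ≠ y) : Alike σ y x u := by
  have e : ∀ {a b : Fin n}, a ≠ b → σ a ≠ σ b := fun h => σ.injective.ne h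
  obtain ⟨a₁, b₁⟩ := h₁
  obtain ⟨a₂, b₂⟩ := h₂
  obtain ⟨a₃, b₃⟩ := h₃
  constructor
  · rw [lt_iff_not_lt_of_ne hxy.symm, lt_iff_not_lt_of_ne huy.symm, ← a₁, ← a₃,
      ← lt_iff_not_lt_of_ne hxv.symm, ← lt_iff_not_lt_of_ne huv.symm, a₂]
  · rw [lt_iff_not_lt_of_ne (e hxy.symm), lt_iff_not_lt_of_ne (e huy.symm), ← b₁, ← b₃,
      ← lt_iff_not_lt_of_ne (e hxv.symm), ← lt_iff_not_lt_of_ne (e huv.symm), b₂]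

end Alike

/-! ## Simple permutations and modules -/

section Interval

variable {n : ℕ} {σ : Equiv.Perm (Fin n)} {M : Set (Fin n)}

theorem IsModuleOn.mem_of_between (h : IsModuleOn σ Set.univ M) {x y z : Fin n} (hy : y ∈ M)
    (hz : z ∈ M) (hyx : y ≤ x) (hxz : x ≤ z) : x ∈ M := by
  by_contra hx
  have hyx' : y ≠ x := fun e => hx (e ▸ hy)
  have hxz' : x ≠ z := fun e => hx (e ▸ hz)
  have := (h.2 x trivial hx y hy z hz).1
  have : x < y := this.2 (lt_of_le_of_ne hxz hxz')
  exact absurd this (not_lt.2 hyx)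

theorem IsModuleOn.mem_of_value_between (h : IsModuleOn σ Set.univ M) {x y z : Fin n} (hy : y ∈ M)
    (hz : z ∈ M) (hyx : σ y ≤ σ x) (hxz : σ x ≤ σ z) : x ∈ M := by
  by_contra hx
  have hyx' : σ y ≠ σ x := fun e => hx (σ.injective e ▸ hy)
  have hxz' : σ x ≠ σ z := fun e => hx (σ.injective e ▸ hz)
  have := (h.2 x trivial hx y hy z hz).2
  have : σ x < σ y := this.2 (lt_of_le_of_ne hxz hxz')
  exact absurd this (not_lt.2 hyx)

theorem isInterval_of_isModuleOn (h : IsModuleOn σ Set.univ M) (hne : M.Nonempty) :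
    ∃ a b, IsInterval σ a b ∧ M = Set.Icc a b := by
  obtain ⟨a, ha, ha'⟩ := Set.exists_min_image M id (Set.toFinite M) hne
  obtain ⟨b, hb, hb'⟩ := Set.exists_max_image M id (Set.toFinite M) hne
  obtain ⟨c, hc, hc'⟩ := Set.exists_min_image M σ (Set.toFinite M) hne
  obtain ⟨d, hd, hd'⟩ := Set.exists_max_image M σ (Set.toFinite M) hne
  have hM : M = Set.Icc a b := by
    ext x
    exact ⟨fun hx => ⟨ha' x hx, hb' x hx⟩, fun hx => h.mem_of_between ha hb hx.1 hx.2⟩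
  refine ⟨a, b, ⟨ha' b hb, σ c, σ d, ?_⟩, hM⟩
  ext v
  have key : ∀ x, x ∈ Finset.Icc a b ↔ x ∈ M := fun x => by rw [hM]; simp
  simp only [Finset.mem_image, key]
  rw [Finset.mem_Icc]
  constructor
  · rintro ⟨x, hx, rfl⟩
    exact ⟨hc' x hx, hd' x hx⟩
  · rintro ⟨h1, h2⟩
    refine ⟨σ.symm v, h.mem_of_value_between hc hd ?_ ?_, by simp⟩ <;> simpa

theorem isModuleOn_of_isInterval {a b : Fin n} (h : IsInterval σ a b) :
    IsModuleOn σ Set.univ (Set.Icc a b) := by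
  obtain ⟨hab, c, d, hcd⟩ := h
  have key : ∀ x, x ∈ Set.Icc a b ↔ σ x ∈ Finset.Icc c d := by
    intro x
    rw [← hcd]
    simp
  refine ⟨Set.subset_univ _, fun x _ hx y hy z hz => ⟨?_, ?_⟩⟩
  · simp only [Set.mem_Icc, Fin.le_def] at hx hy hz
    simp only [Fin.lt_def]
    omega
  · rw [key, Finset.mem_Icc, Fin.le_def, Fin.le_def] at hx hy hz
    simp only [Fin.lt_def]
    omega

/-- The nonempty modules of the whole permutation are exactly its intervals. -/
theorem isSimple_iff : IsSimple σ ↔ 1 ≤ n ∧ SimpleOn σ Set.univ := by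
  refine and_congr_right fun hn => ⟨fun h M hM => ?_, fun h a b hab => ?_⟩
  · rcases M.eq_empty_or_nonempty with rfl | hne
    · exact Or.inl Set.subsingleton_empty
    obtain ⟨a, b, hab, rfl⟩ := isInterval_of_isModuleOn hM hne
    refine (h a b hab).imp ?_ fun h => ?_
    · rintro rfl; simp
    · ext x; simpa using Finset.ext_iff.1 h x
  · refine (h _ (isModuleOn_of_isInterval hab)).imp (fun h => ?_) fun h => ?_
    · exact h ⟨le_rfl, hab.1⟩ ⟨hab.1, le_rfl⟩
    · ext x; simpa using Set.ext_iff.1 h x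

end Interval

/-- Modules depend only on the separation relation, so `g` need not be monotone. This serves for
occurrences of patterns, for inverses and for the exchange of twins. -/
theorem simpleOn_image {n k : ℕ} {σ : Equiv.Perm (Fin n)} {τ : Equiv.Perm (Fin k)}
    {g : Fin k → Fin n} {S : Set (Fin k)} (hg : Set.InjOn g S)
    (h : ∀ x ∈ S, ∀ y ∈ S, ∀ z ∈ S, x ≠ y → x ≠ z →
      (Alike τ x y z ↔ Alike σ (g x) (g y) (g z))) :
    SimpleOn σ (g '' S) ↔ SimpleOn τ S := by
  constructor
  · intro hs M hM
    have hmod : IsModuleOn σ (g '' S) (g '' M) := by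
      refine ⟨Set.image_mono hM.1, ?_⟩
      rintro _ ⟨x, hx, rfl⟩ hxM _ ⟨y, hy, rfl⟩ _ ⟨z, hz, rfl⟩
      have hx' : x ∉ M := fun h => hxM ⟨x, h, rfl⟩
      exact (h x hx y (hM.1 hy) z (hM.1 hz) (fun e => hx' (e ▸ hy)) fun e => hx' (e ▸ hz)).1
        (hM.2 x hx hx' y hy z hz)
    refine (hs _ hmod).imp (fun h y hy z hz => ?_) fun h => ?_
    · exact hg (hM.1 hy) (hM.1 hz) (h ⟨y, hy, rfl⟩ ⟨z, hz, rfl⟩)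
    · refine hM.1.antisymm fun x hx => ?_
      obtain ⟨y, hy, e⟩ := h.ge ⟨x, hx, rfl⟩
      rwa [← hg (hM.1 hy) hx e]
  · intro hs M hM
    have hMe : g '' (S ∩ g ⁻¹' M) = M := by
      rw [Set.image_inter_preimage, Set.inter_eq_right.2 hM.1]
    have hmod : IsModuleOn τ S (S ∩ g ⁻¹' M) := by
      refine ⟨Set.inter_subset_left, fun x hx hxM y hy z hz => ?_⟩
      refine (h x hx y hy.1 z hz.1 (fun e => hxM (e ▸ hy)) fun e => hxM (e ▸ hz)).2 ?_
      exact hM.2 _ ⟨x, hx, rfl⟩ (fun h => hxM ⟨hx, h⟩) _ hy.2 _ hz.2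
    refine (hs _ hmod).imp (fun h => ?_) fun h => ?_
    · rw [← hMe]; exact h.image g
    · rw [← hMe, h]

/-! ## Copies of patterns -/

/-- `g` lists the positions of an occurrence of `π` in `σ`. -/
def IsCopy {k n : ℕ} (π : Equiv.Perm (Fin k)) (σ : Equiv.Perm (Fin n)) (g : Fin k → Fin n) :
    Prop :=
  (∀ i j, i < j ↔ g i < g j) ∧ ∀ i j, π i < π j ↔ σ (g i) < σ (g j)

section Copy

variable {k l n : ℕ} {π : Equiv.Perm (Fin k)} {τ : Equiv.Perm (Fin l)} {σ : Equiv.Perm (Fin n)}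
  {g : Fin k → Fin n}

theorem IsCopy.strictMono (h : IsCopy π σ g) : StrictMono g := fun _ _ hij => (h.1 _ _).1 hij

theorem isPattern_iff : IsPattern π σ ↔ ∃ g, IsCopy π σ g := by
  constructor
  · rintro ⟨f, hf⟩
    exact ⟨f, fun i j => f.lt_iff_lt.symm, hf⟩
  · rintro ⟨g, hg⟩
    exact ⟨OrderEmbedding.ofStrictMono g hg.strictMono, hg.2⟩

theorem IsCopy.comp {f : Fin k → Fin l} {g : Fin l → Fin n} (hg : IsCopy τ σ g)
    (hf : IsCopy π τ f) : IsCopy π σ (g ∘ f) :=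
  ⟨fun i j => (hf.1 i j).trans (hg.1 _ _), fun i j => (hf.2 i j).trans (hg.2 _ _)⟩

theorem IsPattern.trans (h : IsPattern π τ) (h' : IsPattern τ σ) : IsPattern π σ := by
  rw [isPattern_iff] at *
  obtain ⟨f, hf⟩ := h
  obtain ⟨g, hg⟩ := h'
  exact ⟨_, hg.comp hf⟩

theorem IsPattern.refl (σ : Equiv.Perm (Fin n)) : IsPattern σ σ :=
  isPattern_iff.2 ⟨id, fun _ _ => Iff.rfl, fun _ _ => Iff.rfl⟩

theorem IsPattern.le (h : IsPattern π σ) : k ≤ n := by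
  obtain ⟨g, -⟩ := h
  simpa using Fintype.card_le_of_injective g g.injective

theorem IsCopy.simpleOn_range (h : IsCopy π σ g) :
    SimpleOn σ (Set.range g) ↔ SimpleOn π Set.univ := by
  rw [← Set.image_univ]
  refine simpleOn_image h.strictMono.injective.injOn fun x _ y _ z _ _ _ => ?_
  rw [Alike, Alike, h.2, h.2, h.1, h.1]

theorem perm_eq_one_of_lt_iff {α : Equiv.Perm (Fin n)} (h : ∀ i j, i < j ↔ α i < α j) : α = 1 := by
  have hm : StrictMono α := fun i j hij => (h i j).1 hij
  have : (hm.orderIsoOfSurjective α α.surjective) = OrderIso.refl _ := Subsingleton.elim _ _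
  ext i
  exact congrArg (fun e : Fin n ≃o Fin n => ((e i : Fin n) : ℕ)) this

/-- A linear order on `n` points has no automorphism but the identity; this applies to the embedding
of positions, then to values. -/
theorem IsPattern.eq {π σ : Equiv.Perm (Fin n)} (h : IsPattern π σ) : π = σ := by
  obtain ⟨g, hg⟩ := h
  have hb : Function.Bijective g := Finite.injective_iff_bijective.1 g.injective
  have h1 : Equiv.ofBijective g hb = 1 := perm_eq_one_of_lt_iff fun i j => by simp
  have h2 : ∀ i, g i = i := fun i => by simpa using congrArg (fun e => e i) h1
  have h3 : π⁻¹ * σ = 1 := by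
    rw [inv_mul_eq_one]
    have : σ * π⁻¹ = 1 := perm_eq_one_of_lt_iff fun i j => by
      have := hg (π⁻¹ i) (π⁻¹ j)
      simpa [h2] using this
    exact (mul_inv_eq_one.1 this).symm
  exact inv_mul_eq_one.1 h3

/-- Inversion exchanges positions and values. It reduces exceptional types 1 and 2 to types 3 and 4.
-/
theorem IsCopy.inv (h : IsCopy π σ g) : IsCopy π⁻¹ σ⁻¹ (fun i => σ (g (π⁻¹ i))) :=
  ⟨fun i j => by simpa using h.2 (π⁻¹ i) (π⁻¹ j), fun i j => by simpa using h.1 (π⁻¹ i) (π⁻¹ j)⟩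

theorem IsPattern.inv (h : IsPattern π σ) : IsPattern π⁻¹ σ⁻¹ := by
  obtain ⟨g, hg⟩ := isPattern_iff.1 h
  exact isPattern_iff.2 ⟨_, hg.inv⟩

theorem simpleOn_inv {S : Set (Fin n)} : SimpleOn σ⁻¹ (σ '' S) ↔ SimpleOn σ S :=
  simpleOn_image σ.injective.injOn fun x _ y _ z _ _ _ => by
    simp only [Alike, Equiv.Perm.inv_def, Equiv.symm_apply_apply]; exact and_comm

theorem IsSimple.inv (h : IsSimple σ) : IsSimple σ⁻¹ := by
  rw [isSimple_iff] at *
  refine ⟨h.1, ?_⟩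
  have := simpleOn_inv.2 h.2
  rwa [Set.image_univ_of_surjective σ.surjective] at this

end Copy

/-! ### Deletion and insertion of one point -/

section Delete

variable {k n : ℕ} (σ : Equiv.Perm (Fin (n + 1))) (i : Fin (n + 1))

theorem isCopy_deletePoint : IsCopy (deletePoint σ i) σ i.succAbove := by
  refine ⟨fun a b => (Fin.succAbove_lt_succAbove_iff).symm, fun a b => ?_⟩
  rw [← succAbove_deletePoint, ← succAbove_deletePoint, Fin.succAbove_lt_succAbove_iff]

theorem isPattern_deletePoint : IsPattern (deletePoint σ i) σ :=
  isPattern_iff.2 ⟨_, isCopy_deletePoint σ i⟩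

theorem simpleOn_deletePoint : SimpleOn (deletePoint σ i) Set.univ ↔ SimpleOn σ {i}ᶜ := by
  rw [← (isCopy_deletePoint σ i).simpleOn_range, Fin.range_succAbove]

theorem IsCopy.isPattern_deletePoint {π : Equiv.Perm (Fin k)} {σ : Equiv.Perm (Fin (n + 1))}
    {i : Fin (n + 1)} {g : Fin k → Fin (n + 1)} (h : IsCopy π σ g) (hi : ∀ j, g j ≠ i) :
    IsPattern π (deletePoint σ i) := by
  choose f hf using fun j => Fin.exists_succAbove_eq (hi j)
  have hd := isCopy_deletePoint σ i
  refine isPattern_iff.2 ⟨f, fun a b => ?_, fun a b => ?_⟩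
  · rw [hd.1, hf, hf, h.1]
  · rw [hd.2, hf, hf, h.2]

theorem insertPoint_deletePoint : insertPoint (deletePoint σ i) i (σ i) = σ := by
  ext j
  rcases Fin.eq_self_or_eq_succAbove i j with rfl | ⟨j, rfl⟩
  · rw [insertPoint_self]
  · rw [insertPoint_succAbove, succAbove_deletePoint]

theorem deletePoint_insertPoint (π : Equiv.Perm (Fin n)) (v : Fin (n + 1)) :
    deletePoint (insertPoint π i v) i = π := by
  ext j
  have := succAbove_deletePoint (insertPoint π i v) i j
  rw [insertPoint_self, insertPoint_succAbove] at this
  rw [Fin.succAbove_right_injective this]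

end Delete

/-! ## Extension of simple restrictions -/

section Extension

variable {n : ℕ} {σ : Equiv.Perm (Fin n)} {Q : Set (Fin n)}

/-- If one more point destroys simplicity, then the point sees the rest as a whole or it is a twin
of some other point. -/
theorem alike_or_twin_of_not_simpleOn_insert (hQ : SimpleOn σ Q) {x : Fin n} (hx : x ∉ Q)
    (h : ¬ SimpleOn σ (insert x Q)) :
    (∀ p ∈ Q, ∀ q ∈ Q, Alike σ x p q) ∨ ∃ u ∈ Q, ∀ q ∈ Q, q ≠ u → Alike σ q x u := by
  simp only [SimpleOn, not_forall, not_or] at h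
  obtain ⟨M, hM, hns, hne⟩ := h
  -- The trace on `Q` of a nontrivial module `M` is trivial: if it has at most one point, `M`
  -- consists of `x` and its twin; if it is `Q`, then `M = Q`.
  have hmod : IsModuleOn σ Q (M ∩ Q) :=
    ⟨Set.inter_subset_right, fun y hy hyM z hz w hw =>
      hM.2 y (Or.inr hy) (fun h => hyM ⟨h, hy⟩) z hz.1 w hw.1⟩
  rcases hQ _ hmod with h | h
  · right
    have hxM : x ∈ M := by
      by_contra hxM
      refine hns (h.anti fun y hy => ⟨hy, ?_⟩)
      exact (hM.1 hy).resolve_left fun e => hxM (e ▸ hy)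
    obtain ⟨u, hu, hux⟩ : ∃ u ∈ M, u ≠ x := by
      by_contra! hcon
      exact hns fun y hy z hz => (hcon y hy).trans (hcon z hz).symm
    have huQ : u ∈ Q := (hM.1 hu).resolve_left hux
    refine ⟨u, huQ, fun q hq hqu => hM.2 q (Or.inr hq) (fun hqM => hqu ?_) x hxM u hu⟩
    exact h ⟨hqM, hq⟩ ⟨hu, huQ⟩
  · left
    have hxM : x ∉ M := by
      intro hxM
      refine hne (hM.1.antisymm ?_)
      rintro y (rfl | hy)
      · exact hxM
      · exact (h.ge hy).1
    exact fun p hp q hq => hM.2 x (Or.inl rfl) hxM p (h.ge hp).1 q (h.ge hq).1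

/-- The twin `x` of `u` is harmless once `y` separates the two, provided that `y` is not itself a
twin of `u`. The hypothesis `h3` says that `Q` has at least three points, so that pairs in `Q` are
not modules. -/
theorem simpleOn_insert_insert (hQ : SimpleOn σ Q) (h3 : ∀ u v, ∃ w ∈ Q, w ≠ u ∧ w ≠ v)
    {x y u : Fin n} (hx : x ∉ Q) (hy : y ∉ Q) (hu : u ∈ Q)
    (hxu : ∀ q ∈ Q, q ≠ u → Alike σ q x u) (hyu : ¬ ∀ q ∈ Q, q ≠ u → Alike σ q y u)
    (hs : ¬ Alike σ y x u) : SimpleOn σ (insert x (insert y Q)) := by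
  have ne : ∀ {q z}, q ∈ Q → z ∉ Q → q ≠ z := fun hq hz e => hz (e ▸ hq)
  have hnotwin : ∀ v ∈ Q, (∀ q ∈ Q, q ≠ u → q ≠ v → Alike σ q u v) → u = v := by
    intro v hv h
    have hmod : IsModuleOn σ Q {u, v} := by
      refine ⟨by rintro _ (rfl | rfl) <;> assumption, fun q hq hquv => ?_⟩
      simp only [Set.mem_insert_iff, Set.mem_singleton_iff, not_or] at hquv
      have := h q hq hquv.1 hquv.2
      rintro _ (rfl | rfl) _ (rfl | rfl)
      exacts [Alike.refl .., this, this.symm, Alike.refl ..]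
    rcases hQ _ hmod with h | h
    · exact h (Or.inl rfl) (Or.inr rfl)
    · obtain ⟨w, hw, hwu, hwv⟩ := h3 u v
      rw [← h] at hw
      exact absurd hw (by simp [hwu, hwv])
  intro M hM
  by_contra hcon
  obtain ⟨hns, hne⟩ := not_or.1 hcon
  have hmod : IsModuleOn σ Q (M ∩ Q) :=
    ⟨Set.inter_subset_right, fun z hz hzM a ha b hb =>
      hM.2 z (Or.inr (Or.inr hz)) (fun h => hzM ⟨h, hz⟩) a ha.1 b hb.1⟩
  have hMQ : ∀ q ∈ Q, q ∉ M → ∀ a ∈ M, ∀ b ∈ M, Alike σ q a b := fun q hq =>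
    hM.2 q (Or.inr (Or.inr hq))
  rcases hQ _ hmod with h | h
  · by_cases hxM : x ∈ M
    · by_cases hyM : y ∈ M
      · by_cases hv : ∃ v ∈ M, v ∈ Q
        · obtain ⟨v, hvM, hvQ⟩ := hv
          have hnot : ∀ q ∈ Q, q ≠ v → q ∉ M := fun q hq hqv hqM => hqv (h ⟨hqM, hq⟩ ⟨hvM, hvQ⟩)
          have huv : u = v := hnotwin v hvQ fun q hq hqu hqv =>
            (hxu q hq hqu).symm.trans (hMQ q hq (hnot q hq hqv) x hxM v hvM)
          subst huv
          exact hyu fun q hq hqu => hMQ q hq (hnot q hq hqu) y hyM u hvM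
        · push Not at hv
          exact hyu fun q hq hqu =>
            (hMQ q hq (fun h => hv q h hq) y hyM x hxM).trans (hxu q hq hqu)
      · obtain ⟨v, hvM, hvx⟩ : ∃ v ∈ M, v ≠ x := by
          by_contra! hcon
          exact hns fun a ha b hb => (hcon a ha).trans (hcon b hb).symm
        have hvQ : v ∈ Q := ((hM.1 hvM).resolve_left hvx).resolve_left fun e => hyM (e ▸ hvM)
        have hyxv : Alike σ y x v := hM.2 y (Or.inr (Or.inl rfl)) hyM x hxM v hvM
        have hnot : ∀ q ∈ Q, q ≠ v → q ∉ M := fun q hq hqv hqM => hqv (h ⟨hqM, hq⟩ ⟨hvM, hvQ⟩)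
        have huv : u = v := hnotwin v hvQ fun q hq hqu hqv =>
            (hxu q hq hqu).symm.trans (hMQ q hq (hnot q hq hqv) x hxM v hvM)
        exact hs (huv ▸ hyxv)
    · have hyM : y ∈ M := by
        by_contra hyM
        refine hns (h.anti fun z hz => ⟨hz, ?_⟩)
        exact ((hM.1 hz).resolve_left fun e => hxM (e ▸ hz)).resolve_left fun e => hyM (e ▸ hz)
      obtain ⟨v, hvM, hvy⟩ : ∃ v ∈ M, v ≠ y := by
        by_contra! hcon
        exact hns fun a ha b hb => (hcon a ha).trans (hcon b hb).symm
      have hvQ : v ∈ Q := ((hM.1 hvM).resolve_left fun e => hxM (e ▸ hvM)).resolve_left hvy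
      have hnot : ∀ q ∈ Q, q ≠ v → q ∉ M := fun q hq hqv hqM => hqv (h ⟨hqM, hq⟩ ⟨hvM, hvQ⟩)
      have hyv : ∀ q ∈ Q, q ≠ v → Alike σ q y v := fun q hq hqv =>
        hMQ q hq (hnot q hq hqv) y hyM v hvM
      have hvu : v ≠ u := by rintro rfl; exact hyu hyv
      have hxvy : Alike σ x v y := hM.2 x (Or.inl rfl) hxM v hvM y hyM
      -- Here `y` is a twin of `v ≠ u` while `x` is a twin of `u`; following the four points around,
      -- `y` cannot separate `x` from `u`.
      refine hs (Alike.square hxvy (hxu v hvQ hvu) (hyv u hu hvu.symm).symm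
        (ne hvQ hx).symm ?_ hvu.symm (ne hu hy))
      rintro rfl
      exact hxM hyM
  · have hxM : x ∈ M := by
      by_contra hxM
      have hxQ : ∀ p ∈ Q, ∀ q ∈ Q, Alike σ x p q := fun p hp q hq =>
        hM.2 x (Or.inl rfl) hxM p (h.ge hp).1 q (h.ge hq).1
      -- If `x` sees all of `Q` alike, then so does its twin `u`, and removing `u` from `Q` leaves a
      -- nontrivial module.
      have hm : IsModuleOn σ Q (Q \ {u}) := by
        refine ⟨Set.sdiff_subset, fun z hz hzu a ha b hb => ?_⟩
        have : z = u := by by_contra hne; exact hzu ⟨hz, hne⟩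
        subst this
        exact Alike.square (hxu a ha.1 ha.2) (hxQ a ha.1 b hb.1) (hxu b hb.1 hb.2)
          (ne ha.1 hx) ha.2 (ne hb.1 hx) hb.2
      rcases hQ _ hm with h | h
      · obtain ⟨w, hw, hwu, -⟩ := h3 u u
        obtain ⟨w', hw', hwu', hww⟩ := h3 u w
        exact hww (h ⟨hw', hwu'⟩ ⟨hw, hwu⟩)
      · exact (h.ge hu).2 rfl
    by_cases hyM : y ∈ M
    · refine hne (hM.1.antisymm ?_)
      rintro z (rfl | rfl | hz)
      exacts [hxM, hyM, (h.ge hz).1]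
    · exact hs (hM.2 y (Or.inr (Or.inl rfl)) hyM x hxM u (h.ge hu).1)

/-- The case `x = y` is allowed and stands for adding a single point. If no addition works, either
`Q` itself or the class of some `u ∈ Q` together with its twins outside `Q` is a nontrivial module
of `σ`. -/
theorem exists_simpleOn_insert_insert (hσ : SimpleOn σ Set.univ) (hQ : SimpleOn σ Q)
    (h3 : ∀ u v, ∃ w ∈ Q, w ≠ u ∧ w ≠ v) (hne : Q ≠ Set.univ) :
    ∃ x ∉ Q, ∃ y ∉ Q, SimpleOn σ (insert x (insert y Q)) := by
  by_contra! hcon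
  have hext : ∀ x ∉ Q, (∀ p ∈ Q, ∀ q ∈ Q, Alike σ x p q) ∨
      ∃ u ∈ Q, ∀ q ∈ Q, q ≠ u → Alike σ q x u := fun x hx =>
    alike_or_twin_of_not_simpleOn_insert hQ hx (by simpa using hcon x hx x hx)
  obtain ⟨x₀, hx₀, u, hu, hxu⟩ : ∃ x ∉ Q, ∃ u ∈ Q, ∀ q ∈ Q, q ≠ u → Alike σ q x u := by
    by_contra! hc
    have hmod : IsModuleOn σ Set.univ Q := ⟨Set.subset_univ _, fun x _ hx =>
      (hext x hx).resolve_right fun ⟨u, hu, h⟩ => by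
        obtain ⟨q, hq, hqu, hn⟩ := hc x hx u hu
        exact hn (h q hq hqu)⟩
    rcases hσ _ hmod with h | h
    · obtain ⟨x₀, -⟩ := (Set.ne_univ_iff_exists_notMem Q).1 hne
      obtain ⟨w, hw, -⟩ := h3 x₀ x₀
      obtain ⟨w', hw', hww, -⟩ := h3 w w
      exact hww (h hw' hw)
    · exact hne h
  set T : Set (Fin n) := {x | x = u ∨ x ∉ Q ∧ ∀ q ∈ Q, q ≠ u → Alike σ q x u} with hT
  have huT : u ∈ T := Or.inl rfl
  have hmod : IsModuleOn σ Set.univ T := by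
    refine ⟨Set.subset_univ _, fun y _ hy => ?_⟩
    have key : ∀ a ∈ T, Alike σ y a u := by
      rintro a (rfl | ⟨ha, hau⟩)
      · exact Alike.refl ..
      · by_cases hyQ : y ∈ Q
        · exact hau y hyQ fun e => hy (e ▸ huT)
        · by_contra hs
          exact hcon a ha y hyQ (simpleOn_insert_insert hQ h3 ha hyQ hu hau
            (fun h => hy (Or.inr ⟨hyQ, h⟩)) hs)
    exact fun a ha b hb => (key a ha).trans (key b hb).symm
  rcases hσ _ hmod with h | h
  · exact hx₀ (h huT (Or.inr ⟨hx₀, hxu⟩) ▸ hu)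
  · obtain ⟨w, hw, hwu, -⟩ := h3 u u
    rcases h.ge (Set.mem_univ w) with h | h
    · exact hwu h
    · exact h.1 hw

/-- `Q` grows until the next step would reach the whole permutation; the points of that step are `a`
and `b`, possibly equal. -/
theorem exists_simpleOn_compl_pair (hσ : SimpleOn σ Set.univ) (Q : Set (Fin n))
    (hQ : SimpleOn σ Q) (h3 : ∀ u v, ∃ w ∈ Q, w ≠ u ∧ w ≠ v) (hne : Q ≠ Set.univ) :
    ∃ a b, Q ⊆ {a, b}ᶜ ∧ SimpleOn σ {a, b}ᶜ := by
  obtain ⟨x, hx, y, hy, hs⟩ := exists_simpleOn_insert_insert hσ hQ h3 hne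
  by_cases hu : insert x (insert y Q) = Set.univ
  · have : Q = {x, y}ᶜ := by
      ext z
      have := hu.ge (Set.mem_univ z)
      simp only [Set.mem_insert_iff, Set.mem_compl_iff, Set.mem_singleton_iff] at this ⊢
      constructor
      · intro hz
        rintro (rfl | rfl)
        exacts [hx hz, hy hz]
      · tauto
    exact ⟨x, y, this.le, this ▸ hQ⟩
  · have hsub : Q ⊆ insert x (insert y Q) := fun z hz => Or.inr (Or.inr hz)
    obtain ⟨a, b, hab, h⟩ := exists_simpleOn_compl_pair hσ _ hs
      (fun u v => (h3 u v).imp fun w hw => ⟨hsub hw.1, hw.2⟩) hu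
    exact ⟨a, b, hsub.trans hab, h⟩
termination_by Qᶜ.ncard
decreasing_by
  refine Set.ncard_lt_ncard ?_ (Set.toFinite _)
  exact compl_lt_compl_iff_lt.2 ⟨hsub, fun h => hx (h (Or.inl rfl))⟩

end Extension

theorem ncard_pair_le {α : Type*} (a b : α) : ({a, b} : Set α).ncard ≤ 2 :=
  (Set.ncard_insert_le a {b}).trans (by rw [Set.ncard_singleton])

theorem ncard_triple_le {α : Type*} (a b c : α) : ({a, b, c} : Set α).ncard ≤ 3 :=
  (Set.ncard_insert_le a {b, c}).trans (Nat.succ_le_succ (ncard_pair_le b c))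

/-! ## Twins -/

section Twin

variable {k n : ℕ} {π : Equiv.Perm (Fin k)} {σ : Equiv.Perm (Fin n)} {x y u : Fin n}

/-- After deletion of the point at position `x`, no point separates those at `y` and `u`. -/
def IsTwin (σ : Equiv.Perm (Fin n)) (x y u : Fin n) : Prop :=
  ∀ q, q ≠ x → q ≠ y → q ≠ u → Alike σ q y u

theorem IsTwin.symm (h : IsTwin σ x y u) : IsTwin σ x u y := fun q h1 h2 h3 => (h q h1 h3 h2).symm

/-- Exchanging twins identifies the permutation without `x, y` with the one without `x, u`.
Simplicity and occurrences of patterns are carried over in this way. -/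
theorem IsTwin.lt_iff (h : IsTwin σ x y u) {a b : Fin n} (hax : a ≠ x) (hay : a ≠ y)
    (hbx : b ≠ x) (hby : b ≠ y) :
    (a < b ↔ Equiv.swap y u a < Equiv.swap y u b) ∧
      (σ a < σ b ↔ σ (Equiv.swap y u a) < σ (Equiv.swap y u b)) := by
  have e : ∀ {a b : Fin n}, a ≠ b → σ a ≠ σ b := fun h => σ.injective.ne h
  by_cases hau : a = u <;> by_cases hbu : b = u
  · subst hau; subst hbu; simp
  · subst hau
    rw [Equiv.swap_apply_right, Equiv.swap_apply_of_ne_of_ne hby hbu]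
    have := h b hbx hby hbu
    rw [lt_iff_not_lt_of_ne (Ne.symm hbu), lt_iff_not_lt_of_ne (Ne.symm hby),
      lt_iff_not_lt_of_ne (e (Ne.symm hbu)), lt_iff_not_lt_of_ne (e (Ne.symm hby))]
    exact ⟨not_congr this.1.symm, not_congr this.2.symm⟩
  · subst hbu
    rw [Equiv.swap_apply_right, Equiv.swap_apply_of_ne_of_ne hay hau]
    exact (h a hax hay hau).symm
  · rw [Equiv.swap_apply_of_ne_of_ne hay hau, Equiv.swap_apply_of_ne_of_ne hby hbu]
    simp

theorem IsTwin.simpleOn (h : IsTwin σ x y u) (hyx : y ≠ x) (hux : u ≠ x)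
    (hs : SimpleOn σ {x, y}ᶜ) : SimpleOn σ {x, u}ᶜ := by
  have := (simpleOn_image (σ := σ) (τ := σ) (g := Equiv.swap y u) (S := {x, y}ᶜ)
    (Equiv.injective _).injOn fun a ha b hb c hc _ _ => by
      simp only [Set.mem_compl_iff, Set.mem_insert_iff, Set.mem_singleton_iff, not_or] at ha hb hc
      have hb' := h.lt_iff ha.1 ha.2 hb.1 hb.2
      have hc' := h.lt_iff ha.1 ha.2 hc.1 hc.2
      rw [Alike, Alike, hb'.1, hb'.2, hc'.1, hc'.2]).2 hs
  rwa [Set.image_compl_eq (Equiv.bijective _), Set.image_pair, Equiv.swap_apply_left,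
    Equiv.swap_apply_of_ne_of_ne hyx.symm hux.symm] at this

theorem IsTwin.exists_isCopy (h : IsTwin σ x y u) (hyx : y ≠ x) (hux : u ≠ x) {g : Fin k → Fin n}
    (hg : IsCopy π σ g) (hgxy : ∀ i, g i ≠ x ∧ g i ≠ y) :
    ∃ g, IsCopy π σ g ∧ ∀ i, g i ≠ x ∧ g i ≠ u := by
  refine ⟨fun i => Equiv.swap y u (g i), ⟨fun i j => ?_, fun i j => ?_⟩, fun i => ⟨?_, ?_⟩⟩
  · rw [hg.1, (h.lt_iff (hgxy i).1 (hgxy i).2 (hgxy j).1 (hgxy j).2).1]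
  · rw [hg.2, (h.lt_iff (hgxy i).1 (hgxy i).2 (hgxy j).1 (hgxy j).2).2]
  · rw [Ne, Equiv.swap_apply_eq_iff, Equiv.swap_apply_of_ne_of_ne hyx.symm hux.symm]
    exact (hgxy i).1
  · rw [Ne, Equiv.swap_apply_eq_iff, Equiv.swap_apply_right]
    exact (hgxy i).2

/-- Deletion of the points at positions `x` and `y` leaves a simple permutation containing `π`. -/
def IsDoubleDeletion (π : Equiv.Perm (Fin k)) (σ : Equiv.Perm (Fin n)) (x y : Fin n) : Prop :=
  x ≠ y ∧ SimpleOn σ {x, y}ᶜ ∧ ∃ g, IsCopy π σ g ∧ ∀ i, g i ≠ x ∧ g i ≠ y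

/-- No deletion of a single point leaves a simple permutation containing `π`. -/
def NoSingleDeletion (π : Equiv.Perm (Fin k)) (σ : Equiv.Perm (Fin n)) : Prop :=
  ∀ x, SimpleOn σ {x}ᶜ → ∀ g, IsCopy π σ g → ∃ i, g i = x

theorem IsDoubleDeletion.symm (h : IsDoubleDeletion π σ x y) : IsDoubleDeletion π σ y x := by
  obtain ⟨h1, h2, g, hg, hg'⟩ := h
  exact ⟨h1.symm, Set.pair_comm x y ▸ h2, g, hg, fun i => (hg' i).symm⟩

theorem IsDoubleDeletion.inv (h : IsDoubleDeletion π σ x y) :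
    IsDoubleDeletion π⁻¹ σ⁻¹ (σ x) (σ y) := by
  obtain ⟨h1, h2, g, hg, hg'⟩ := h
  refine ⟨σ.injective.ne h1, ?_, _, hg.inv, fun i => ⟨?_, ?_⟩⟩
  · have := simpleOn_inv.2 h2
    rwa [Set.image_compl_eq σ.bijective, Set.image_pair] at this
  · exact σ.injective.ne (hg' _).1
  · exact σ.injective.ne (hg' _).2

theorem NoSingleDeletion.inv (h : NoSingleDeletion π σ) : NoSingleDeletion π⁻¹ σ⁻¹ := by
  intro x hx g hg
  have h1 := simpleOn_inv.2 hx
  rw [Set.image_compl_eq (Equiv.bijective _), Set.image_singleton, inv_inv] at h1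
  have h2 := hg.inv
  rw [inv_inv, inv_inv] at h2
  obtain ⟨i, hi⟩ := h _ h1 _ h2
  exact ⟨_, (Equiv.injective _) hi⟩

theorem IsTwin.inv (h : IsTwin σ x y u) : IsTwin σ⁻¹ (σ x) (σ y) (σ u) := by
  intro q hx hy hu
  have := h (σ⁻¹ q) (fun e => hx (by simp [← e])) (fun e => hy (by simp [← e]))
    (fun e => hu (by simp [← e]))
  simp only [Alike, Equiv.Perm.inv_def, Equiv.apply_symm_apply] at this
  exact ⟨this.2, by simpa [Equiv.Perm.inv_def] using this.1⟩

/-- Restoring `y` alone must destroy simplicity, since the occurrence of `π` still avoids `x`; so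
`y` is one of the two obstructions to extending a simple set by a point. -/
theorem NoSingleDeletion.corner_or_twin (H : NoSingleDeletion π σ)
    (h : IsDoubleDeletion π σ x y) :
    (∀ p, p ≠ x → p ≠ y → ∀ q, q ≠ x → q ≠ y → Alike σ y p q) ∨
      ∃ u, u ≠ x ∧ u ≠ y ∧ IsTwin σ x y u ∧ IsDoubleDeletion π σ x u := by
  obtain ⟨hxy, hs, g, hg, hgxy⟩ := h
  have hins : insert y ({x, y}ᶜ : Set (Fin n)) = {x}ᶜ := by
    ext z
    simp only [Set.mem_insert_iff, Set.mem_compl_iff, Set.mem_singleton_iff, not_or]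
    constructor
    · rintro (rfl | h)
      exacts [hxy.symm, h.1]
    · intro h
      by_cases hz : z = y <;> simp [hz, h]
  have hns : ¬ SimpleOn σ (insert y ({x, y}ᶜ : Set (Fin n))) := by
    rw [hins]
    intro hx
    obtain ⟨i, hi⟩ := H x hx g hg
    exact (hgxy i).1 hi
  rcases alike_or_twin_of_not_simpleOn_insert hs (by simp) hns with h | ⟨u, hu, h⟩
  · exact Or.inl fun p hp hp' q hq hq' => h p (by simp [hp, hp']) q (by simp [hq, hq'])
  · right
    simp only [Set.mem_compl_iff, Set.mem_insert_iff, Set.mem_singleton_iff, not_or] at hu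
    have ht : IsTwin σ x y u := fun q h1 h2 h3 => h q (by simp [h1, h2]) h3
    exact ⟨u, hu.1, hu.2, ht, Ne.symm hu.1, ht.simpleOn hxy.symm hu.1 hs,
      ht.exists_isCopy hxy.symm hu.1 hg hgxy⟩

/-- The points `a, b, c` would form a nontrivial module. The choice `c = a` covers pairs. -/
theorem exists_not_alike (hσ : SimpleOn σ Set.univ) (hn : 4 ≤ n) {a b c : Fin n} (hab : a ≠ b)
    (h : ∀ q, q ≠ a → q ≠ b → q ≠ c → Alike σ q a b ∧ Alike σ q a c) : False := by
  have hmod : IsModuleOn σ Set.univ {a, b, c} := by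
    refine ⟨Set.subset_univ _, fun q _ hq => ?_⟩
    simp only [Set.mem_insert_iff, Set.mem_singleton_iff, not_or] at hq
    have key : ∀ y ∈ ({a, b, c} : Set (Fin n)), Alike σ q a y := by
      have := h q hq.1 hq.2.1 hq.2.2
      rintro y (rfl | rfl | rfl)
      exacts [Alike.refl .., this.1, this.2]
    exact fun y hy z hz => (key y hy).symm.trans (key z hz)
  rcases hσ _ hmod with h | h
  · exact hab (h (by simp) (by simp))
  · have h1 := congrArg Set.ncard h
    rw [Set.ncard_univ, Nat.card_fin] at h1
    have h2 : ({a, b, c} : Set (Fin n)).ncard ≤ 3 := ncard_triple_le a b c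
    omega

/-- Twins that are separated by position are continued by further twins. -/
theorem NoSingleDeletion.exists_next (H : NoSingleDeletion π σ) (hσ : SimpleOn σ Set.univ)
    (hn : 4 ≤ n) {a b u : Fin n} (ht : IsTwin σ b a u) (hG : IsDoubleDeletion π σ b u)
    (h : ((a : ℕ) + 1 = b ∧ (b : ℕ) + 1 = u ∧ (u : ℕ) + 1 < n) ∨
      ((u : ℕ) + 1 = b ∧ (b : ℕ) + 1 = a ∧ 0 < (u : ℕ))) :
    ∃ w : Fin n, IsTwin σ u b w ∧ IsDoubleDeletion π σ u w ∧
      (((a : ℕ) < b ∧ (w : ℕ) = u + 1) ∨ ((b : ℕ) < a ∧ (w : ℕ) + 1 = u)) := by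
  have hab : a ≠ b := by rintro rfl; omega
  have hau : a ≠ u := by rintro rfl; omega
  have hbu : b ≠ u := by rintro rfl; omega
  obtain ⟨v, hv⟩ : ∃ v : Fin n, ((a : ℕ) < b ∧ (v : ℕ) = u + 1) ∨
      ((b : ℕ) < a ∧ (v : ℕ) + 1 = u) := by
    rcases h with h | h
    · exact ⟨⟨u + 1, h.2.2⟩, Or.inl ⟨by omega, rfl⟩⟩
    · exact ⟨⟨u - 1, by omega⟩, Or.inr ⟨by omega, by simp only; omega⟩⟩
  have hva : v ≠ a := by rintro rfl; omega
  have hvb : v ≠ b := by rintro rfl; omega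
  have hvu : v ≠ u := by rintro rfl; omega
  -- Restoring `b` this time: it is no corner, because `a` and `v` lie on different sides of it. Its
  -- twin `w` must be the neighbour `v` of `u`, as `a` and `v` may not separate `b` from `w`.
  rcases H.corner_or_twin hG.symm with hc | ⟨w, hwu, hwb, htw, hGw⟩
  · have := (hc a hau hab v hvu hvb).1
    simp only [Fin.lt_def] at this
    omega
  · refine ⟨w, htw, hGw, ?_⟩
    have hwa : w ≠ a := by
      rintro rfl
      exact exists_not_alike hσ hn hwb fun q h1 h2 h3 => ⟨(htw q h3 h2 h1).symm, ht q h2 h1 h3⟩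
    have h1 := (htw a hau hab hwa.symm).1
    simp only [Fin.lt_def] at h1
    by_cases hvw : v = w
    · rw [← hvw]; exact hv
    have h2 := (htw v hvu hvb hvw).1
    simp only [Fin.lt_def] at h2
    have := Fin.val_ne_of_ne hwa
    have := Fin.val_ne_of_ne hwb
    have := Fin.val_ne_of_ne hwu
    have := Fin.val_ne_of_ne hvw
    omega

theorem IsTwin.val_eq (h : IsTwin σ x y u) (hyx : y < x) (hxu : x < u) :
    (y : ℕ) + 1 = x ∧ (x : ℕ) + 1 = u := by
  have key : ∀ q : Fin n, y < q → q < u → q = x := by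
    intro q h1 h2
    by_contra hq
    have := (h q hq h1.ne' h2.ne).1
    exact absurd (this.2 h2) h1.not_gt
  simp only [Fin.lt_def] at *
  constructor
  · have := key ⟨y + 1, by omega⟩ (by simp) (by simp; omega)
    exact congrArg Fin.val this
  · by_contra hne
    have := key ⟨x + 1, by omega⟩ (by simp; omega) (by simp; omega)
    have := congrArg Fin.val this
    simp at this

theorem NoSingleDeletion.isTwin_of_isTwin (H : NoSingleDeletion π σ) (hσ : SimpleOn σ Set.univ)
    (hn : 4 ≤ n) (hyx : y < x) (hxu : x < u) (ht : IsTwin σ x y u)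
    (hG : IsDoubleDeletion π σ x y) (hG' : IsDoubleDeletion π σ x u) (p : ℕ) (hp : p + 2 < n) :
    IsTwin σ ⟨p + 1, by omega⟩ ⟨p, by omega⟩ ⟨p + 2, hp⟩ := by
  -- Both double deletions are kept in the invariant, since moving right consumes the one with `c`
  -- and moving left the one with `a`.
  let P : ℕ → Prop := fun p => ∀ a b c : Fin n, (a : ℕ) = p → (b : ℕ) = p + 1 → (c : ℕ) = p + 2 →
    IsTwin σ b a c ∧ IsDoubleDeletion π σ b a ∧ IsDoubleDeletion π σ b c
  have hright : ∀ p, p + 3 < n → P p → P (p + 1) := by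
    intro p hp h b c w hb hc hw
    obtain ⟨h1, h2, h3⟩ := h ⟨p, by omega⟩ b c rfl hb hc
    obtain ⟨w', hw', hG', hor⟩ := H.exists_next hσ hn h1 h3
      (Or.inl ⟨by simp; omega, by omega, by omega⟩)
    have : w' = w := by
      ext
      simp only at hor
      omega
    subst this
    exact ⟨hw', h3.symm, hG'⟩
  have hleft : ∀ p, p + 3 < n → P (p + 1) → P p := by
    intro p hp h w a b hw ha hb
    obtain ⟨h1, h2, h3⟩ := h a b ⟨p + 3, by omega⟩ ha hb rfl
    obtain ⟨w', hw', hG', hor⟩ := H.exists_next hσ hn h1.symm h2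
      (Or.inr ⟨by omega, by simp; omega, by omega⟩)
    have : w' = w := by
      ext
      simp only at hor
      omega
    subst this
    exact ⟨hw'.symm, hG', h2.symm⟩
  obtain ⟨e1, e2⟩ := ht.val_eq hyx hxu
  have h0 : P y := by
    intro a b c ha hb hc
    obtain rfl : a = y := Fin.ext ha
    obtain rfl : b = x := Fin.ext (by omega)
    obtain rfl : c = u := Fin.ext (by omega)
    exact ⟨ht, hG, hG'⟩
  have hzero : ∀ p, p + 2 < n → P p → P 0 := by
    intro p
    induction p with
    | zero => exact fun _ h => h
    | succ p ih => exact fun hp h => ih (by omega) (hleft p (by omega) h)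
  have hall : ∀ p, p + 2 < n → P p := by
    intro p
    induction p with
    | zero => exact fun _ => hzero y (by omega) h0
    | succ p ih => exact fun hp => hright p (by omega) (ih (by omega))
  exact (hall p hp _ _ _ rfl rfl rfl).1

/-- Only `x` could have its value strictly between those of the twins, but then `y, x, u` would form
an interval of size 3. -/
theorem IsTwin.value_adjacent (h : IsTwin σ x y u) (hσ : SimpleOn σ Set.univ) (hn : 4 ≤ n)
    (hyx : (y : ℕ) + 1 = x) (hxu : (x : ℕ) + 1 = u) :
    (σ y : ℕ) + 1 = σ u ∨ (σ u : ℕ) + 1 = σ y := by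
  have hyu : y ≠ u := by rintro rfl; omega
  have hxy : y ≠ x := by rintro rfl; omega
  have hσyu := Fin.val_ne_of_ne (σ.injective.ne hyu)
  have key : ∀ q : Fin n, ¬ ((σ y < σ q ∧ σ q < σ u) ∨ (σ u < σ q ∧ σ q < σ y)) := by
    intro q hq
    simp only [Fin.lt_def] at hq
    have hqy : q ≠ y := by rintro rfl; omega
    have hqu : q ≠ u := by rintro rfl; omega
    by_cases hqx : q = x
    · subst hqx
      refine exists_not_alike hσ hn hyu fun z h1 h2 h3 => ⟨h z h3 h1 h2, ?_⟩
      have h4 := h z h3 h1 h2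
      have := Fin.val_ne_of_ne h1
      have := Fin.val_ne_of_ne h2
      have := Fin.val_ne_of_ne h3
      have := Fin.val_ne_of_ne (σ.injective.ne h1)
      have := Fin.val_ne_of_ne (σ.injective.ne h2)
      have := Fin.val_ne_of_ne (σ.injective.ne h3)
      obtain ⟨h4, h5⟩ := h4
      constructor
      · simp only [Fin.lt_def] at *
        omega
      · simp only [Fin.lt_def] at *
        omega
    · have := (h q hqx hqy hqu).2
      simp only [Fin.lt_def] at this
      omega
  by_contra hcon
  rcases lt_or_gt_of_ne hσyu with hlt | hlt
  · refine key (σ.symm ⟨σ y + 1, by omega⟩) (Or.inl ?_)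
    simp only [Equiv.apply_symm_apply, Fin.lt_def]
    omega
  · refine key (σ.symm ⟨σ u + 1, by omega⟩) (Or.inr ?_)
    simp only [Equiv.apply_symm_apply, Fin.lt_def]
    omega

end Twin

/-! ## Recognizing exceptional permutations -/

/-- Along positions of one parity the values move by steps of one, and injectivity forbids turning
back. -/
theorem exists_step_of_adjacent {n : ℕ} {f : ℕ → ℤ}
    (hinj : ∀ p q, p < n → q < n → f p = f q → p = q)
    (hadj : ∀ p, p + 2 < n → f p + 1 = f (p + 2) ∨ f (p + 2) + 1 = f p) (s : ℕ) :
    ∃ ε : ℤ, (ε = 1 ∨ ε = -1) ∧ ∀ i : ℕ, s + 2 * i < n → f (s + 2 * i) = f s + ε * i := by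
  by_cases hs : s + 2 < n
  · refine ⟨f (s + 2) - f s, by have := hadj s hs; omega, ?_⟩
    have step : ∀ i, s + 2 * i + 2 < n → f (s + 2 * i + 2) = f (s + 2 * i) + (f (s + 2) - f s) := by
      intro i
      induction i with
      | zero => intro; simp
      | succ i ih =>
        intro hi
        rw [show s + 2 * (i + 1) = s + 2 * i + 2 by ring] at hi ⊢
        have h1 := ih (by omega)
        have h2 := hadj _ hi
        have h3 := hadj s hs
        have h4 : f (s + 2 * i + 2 + 2) ≠ f (s + 2 * i) := fun h => by
          have := hinj _ _ hi (by omega) h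
          omega
        omega
    intro i
    induction i with
    | zero => intro; simp
    | succ i ih =>
      intro hi
      rw [show s + 2 * (i + 1) = s + 2 * i + 2 by ring] at hi ⊢
      rw [step i hi, ih (by omega)]
      push_cast
      ring
  · refine ⟨1, Or.inl rfl, fun i hi => ?_⟩
    have : i = 0 := by omega
    subst this
    simp

/-- The values at even and at odd positions form two runs of slope `ε` and `δ`. Opposite slopes give
a spiral, which starts or ends with extreme values; `h1` to `h6` exclude this. Equal slopes give
type 3 (both `1`) or type 4 (both `-1`). -/
theorem exceptional_values {n : ℕ} (hn : 4 ≤ n) {f : ℕ → ℤ}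
    (hinj : ∀ p q, p < n → q < n → f p = f q → p = q)
    (hrange : ∀ p, p < n → 0 ≤ f p ∧ f p < n)
    (hsurj : ∀ v : ℤ, 0 ≤ v → v < n → ∃ p < n, f p = v)
    (hadj : ∀ p, p + 2 < n → f p + 1 = f (p + 2) ∨ f (p + 2) + 1 = f p)
    (h1 : f 0 ≠ 0) (h2 : f 0 ≠ n - 1) (h3 : f (n - 1) ≠ 0) (h4 : f (n - 1) ≠ n - 1)
    (h5 : ¬ (f (n - 2) = 0 ∧ f (n - 1) = n - 1)) (h6 : ¬ (f (n - 2) = n - 1 ∧ f (n - 1) = 0)) :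
    ∃ m : ℕ, n = 2 * m ∧
      ((∀ i : ℕ, i < m → f (2 * i) = m + i ∧ f (2 * i + 1) = i) ∨
        ∀ i : ℕ, i < m → f (2 * i) = m - 1 - i ∧ f (2 * i + 1) = 2 * m - 1 - i) := by
  obtain ⟨ε, hε, he⟩ := exists_step_of_adjacent hinj hadj 0
  obtain ⟨δ, hδ, ho⟩ := exists_step_of_adjacent hinj hadj 1
  simp only [zero_add] at he
  obtain ⟨p, hp, hp'⟩ := hsurj 0 le_rfl (by omega)
  obtain ⟨q, hq, hq'⟩ := hsurj (n - 1) (by omega) (by omega)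
  obtain ⟨m, hm⟩ : ∃ m, n = 2 * m ∨ n = 2 * m + 1 := ⟨n / 2, by omega⟩
  have parity : ∀ p, ∃ i, p = 2 * i ∨ p = 1 + 2 * i := fun p => ⟨p / 2, by omega⟩
  obtain ⟨i, hi⟩ := parity p
  obtain ⟨j, hj⟩ := parity q
  have e0 := hrange 0 (by omega)
  have o0 := hrange 1 (by omega)
  have em := hrange (2 * (m - 1)) (by omega)
  have om := hrange (1 + 2 * (m - 1)) (by omega)
  have e0' := he m
  have em'' := hrange (2 * m)
  have em' := he (m - 1) (by omega)
  have om' := ho (m - 1) (by omega)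
  -- Locating the smallest and the largest value on one of the two runs fixes their starting values.
  have zero : f 0 + ε * i = 0 ∧ 2 * i < n ∨ f 1 + δ * i = 0 ∧ 1 + 2 * i < n := by
    rcases hi with rfl | rfl
    · exact Or.inl ⟨(he i hp).symm.trans hp', hp⟩
    · exact Or.inr ⟨(ho i hp).symm.trans hp', hp⟩
  have top : f 0 + ε * j = n - 1 ∧ 2 * j < n ∨ f 1 + δ * j = n - 1 ∧ 1 + 2 * j < n := by
    rcases hj with rfl | rfl
    · exact Or.inl ⟨(he j hq).symm.trans hq', hq⟩
    · exact Or.inr ⟨(ho j hq).symm.trans hq', hq⟩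
  have hcast : ((m - 1 : ℕ) : ℤ) = m - 1 := by omega
  rw [hcast] at em' om'
  clear hinj hrange hsurj hadj hp' hq' hi hj hp hq
  rcases hm with hm | hm
  · clear e0' em''
    refine ⟨m, hm, ?_⟩
    rw [show n - 2 = 2 * (m - 1) by omega, show n - 1 = 1 + 2 * (m - 1) by omega] at *
    rcases hε with rfl | rfl <;> rcases hδ with rfl | rfl
    · left
      intro i hi
      rw [add_comm (2 * i) 1, he i (by omega), ho i (by omega)]
      clear he ho
      rcases zero with zero | zero <;> rcases top with top | top <;> omega
    · clear he ho
      rcases zero with zero | zero <;> rcases top with top | top <;> omega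
    · clear he ho
      rcases zero with zero | zero <;> rcases top with top | top <;> omega
    · right
      intro i hi
      rw [add_comm (2 * i) 1, he i (by omega), ho i (by omega)]
      clear he ho
      rcases zero with zero | zero <;> rcases top with top | top <;> omega
  · exfalso
    have em2 := e0' (by omega)
    have em3 := em'' (by omega)
    clear e0' em'' he ho
    rw [show n - 2 = 1 + 2 * (m - 1) by omega, show n - 1 = 2 * m by omega] at *
    rcases hε with rfl | rfl <;> rcases hδ with rfl | rfl <;>
    rcases zero with zero | zero <;> rcases top with top | top <;> omega

theorem exceptional_apply {n : ℕ} (t : ExcType) (h : n % 2 = 0) (j : Fin n) :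
    (exceptional t n j : ℕ) = excValue t (n / 2) j := by
  rw [exceptional, dif_pos (by omega)]
  rfl

theorem exceptional_symm_apply {n : ℕ} (t : ExcType) (h : n % 2 = 0) (v : Fin n) :
    ((exceptional t n)⁻¹ v : ℕ) = excPosition t (n / 2) v := by
  rw [exceptional, dif_pos (by omega)]
  rfl

theorem inv_exceptional_three {n : ℕ} (h : n % 2 = 0) :
    (exceptional .three n)⁻¹ = exceptional .one n := by
  ext v
  rw [exceptional_symm_apply _ h, exceptional_apply _ h]
  rfl

theorem inv_exceptional_four {n : ℕ} (h : n % 2 = 0) :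
    (exceptional .four n)⁻¹ = exceptional .two n := by
  ext v
  rw [exceptional_symm_apply _ h, exceptional_apply _ h]
  rfl

/-! ### Zigzag permutations with adjacent values two positions apart -/

section Corner

variable {n : ℕ} {σ : Equiv.Perm (Fin n)}

theorem not_corner (hσ : SimpleOn σ Set.univ) (hn : 3 ≤ n) (x : Fin n)
    (hx : (x : ℕ) = 0 ∨ (x : ℕ) + 1 = n) : (σ x : ℕ) ≠ 0 ∧ (σ x : ℕ) + 1 ≠ n := by
  rw [← not_or]
  intro hv
  have hmod : IsModuleOn σ Set.univ {x}ᶜ := by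
    refine ⟨Set.subset_univ _, fun q _ hq y hy z hz => ?_⟩
    simp only [Set.mem_compl_iff, Set.mem_singleton_iff, not_not] at hq hy hz
    subst hq
    have a1 := Fin.val_ne_of_ne hy
    have a2 := Fin.val_ne_of_ne hz
    have a3 := Fin.val_ne_of_ne (σ.injective.ne hy)
    have a4 := Fin.val_ne_of_ne (σ.injective.ne hz)
    simp only [Alike, Fin.lt_def]
    omega
  rcases hσ _ hmod with h | h
  · have h1 := Set.ncard_le_one_iff_subsingleton.2 h
    rw [Set.ncard_compl, Set.ncard_singleton, Nat.card_fin] at h1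
    omega
  · exact (h.ge (Set.mem_univ x)) rfl

theorem not_corner_pair (hσ : SimpleOn σ Set.univ) (hn : 4 ≤ n) (x y : Fin n)
    (hx : (x : ℕ) + 2 = n) (hy : (y : ℕ) + 1 = n) :
    ¬ ((σ x : ℕ) = 0 ∧ (σ y : ℕ) + 1 = n) ∧ ¬ ((σ x : ℕ) + 1 = n ∧ (σ y : ℕ) = 0) := by
  rw [← not_or]
  intro hv
  have hmod : IsModuleOn σ Set.univ {x, y}ᶜ := by
    refine ⟨Set.subset_univ _, fun q _ hq a ha b hb => ?_⟩
    simp only [Set.mem_compl_iff, Set.mem_insert_iff, Set.mem_singleton_iff, not_or]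
      at ha hb
    replace hq : q = x ∨ q = y := by simpa [or_iff_not_imp_left] using hq
    have a1 := Fin.val_ne_of_ne ha.1
    have a2 := Fin.val_ne_of_ne hb.1
    have a3 := Fin.val_ne_of_ne (σ.injective.ne ha.1)
    have a4 := Fin.val_ne_of_ne (σ.injective.ne hb.1)
    have b1 := Fin.val_ne_of_ne ha.2
    have b2 := Fin.val_ne_of_ne hb.2
    have b3 := Fin.val_ne_of_ne (σ.injective.ne ha.2)
    have b4 := Fin.val_ne_of_ne (σ.injective.ne hb.2)
    rcases hq with rfl | rfl <;> simp only [Alike, Fin.lt_def] <;> omega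
  rcases hσ _ hmod with h | h
  · have h1 := Set.ncard_le_one_iff_subsingleton.2 h
    have h2 : ({x, y} : Set (Fin n)).ncard ≤ 2 := ncard_pair_le x y
    rw [Set.ncard_compl, Nat.card_fin] at h1
    omega
  · exact (h.ge (Set.mem_univ x)) (Or.inl rfl)

theorem isExceptional_of_adjacent (hσ : SimpleOn σ Set.univ) (hn : 4 ≤ n)
    (h : ∀ (p : ℕ) (hp : p + 2 < n), (σ ⟨p, by omega⟩ : ℕ) + 1 = σ ⟨p + 2, hp⟩ ∨
      (σ ⟨p + 2, hp⟩ : ℕ) + 1 = σ ⟨p, by omega⟩) :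
    IsExceptional .three σ ∨ IsExceptional .four σ := by
  set f : ℕ → ℤ := fun p => if hp : p < n then (σ ⟨p, hp⟩ : ℕ) else 0 with hf
  have hfp : ∀ p (hp : p < n), f p = (σ ⟨p, hp⟩ : ℕ) := fun p hp => dif_pos hp
  have c0 := not_corner hσ (by omega) ⟨0, by omega⟩ (Or.inl rfl)
  have c1 := not_corner hσ (by omega) ⟨n - 1, by omega⟩ (Or.inr (by simp; omega))
  have c2 := not_corner_pair hσ hn ⟨n - 2, by omega⟩ ⟨n - 1, by omega⟩ (by simp; omega)
    (by simp; omega)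
  obtain ⟨m, hm, hor⟩ := exceptional_values hn (f := f)
    (fun p q hp hq e => by
      rw [hfp p hp, hfp q hq, Nat.cast_inj, Fin.val_inj] at e
      exact congrArg Fin.val (σ.injective e))
    (fun p hp => by rw [hfp p hp]; omega)
    (fun v hv hv' => ⟨σ.symm ⟨v.toNat, by omega⟩, Fin.isLt _, by
      rw [hfp _ (Fin.isLt _), Fin.eta, Equiv.apply_symm_apply]; simp [hv]⟩)
    (fun p hp => by rw [hfp p (by omega), hfp (p + 2) hp]; have := h p hp; omega)
    (by rw [hfp 0 (by omega)]; omega) (by rw [hfp 0 (by omega)]; omega)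
    (by rw [hfp (n - 1) (by omega)]; omega) (by rw [hfp (n - 1) (by omega)]; omega)
    (by rw [hfp (n - 1) (by omega), hfp (n - 2) (by omega)]; omega)
    (by rw [hfp (n - 1) (by omega), hfp (n - 2) (by omega)]; omega)
  refine hor.imp (fun hor => ?_) fun hor => ?_ <;>
  · refine ⟨hn, by omega, Equiv.ext fun j => Fin.ext ?_⟩
    rw [exceptional_apply _ (by omega)]
    have hj := hor (j / 2) (by omega)
    have hj' := hfp j j.isLt
    simp only [excValue]
    split_ifs with hpar
    · rw [show 2 * ((j : ℕ) / 2) = j by omega] at hj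
      simp only [Fin.eta] at hj'
      omega
    · rw [show 2 * ((j : ℕ) / 2) + 1 = j by omega] at hj
      simp only [Fin.eta] at hj'
      omega

end Corner

/-! ### Existence of a good one-point deletion -/

section Deletion

variable {k n : ℕ} {π : Equiv.Perm (Fin k)} {σ : Equiv.Perm (Fin n)}

theorem NoSingleDeletion.isExceptional_of_lt (H : NoSingleDeletion π σ)
    (hσ : SimpleOn σ Set.univ) (hn : 4 ≤ n) {x y u : Fin n} (hyx : y < x) (hxu : x < u)
    (ht : IsTwin σ x y u) (hG : IsDoubleDeletion π σ x y) (hG' : IsDoubleDeletion π σ x u) :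
    IsExceptional .three σ ∨ IsExceptional .four σ :=
  isExceptional_of_adjacent hσ hn fun p hp =>
    (H.isTwin_of_isTwin hσ hn hyx hxu ht hG hG' p hp).value_adjacent hσ hn rfl rfl

theorem NoSingleDeletion.isExceptional_of_separates (H : NoSingleDeletion π σ)
    (hσ : SimpleOn σ Set.univ) (hn : 4 ≤ n) {x y u : Fin n} (hxy : x ≠ y) (hxu : x ≠ u)
    (hs : ¬ (x < y ↔ x < u))
    (ht : IsTwin σ x y u) (hG : IsDoubleDeletion π σ x y) (hG' : IsDoubleDeletion π σ x u) :
    IsExceptional .three σ ∨ IsExceptional .four σ := by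
  rw [lt_iff_not_lt_of_ne hxy] at hs
  rcases lt_or_gt_of_ne hxu with h | h
  · exact H.isExceptional_of_lt hσ hn (by tauto) h ht hG hG'
  · have : x < y := (lt_iff_not_lt_of_ne hxy).2 fun h' => hs (by simp [h', h.not_gt])
    exact H.isExceptional_of_lt hσ hn h this ht.symm hG' hG

/-- By simplicity `x` separates its twins `y` and `u`. Separation by position gives type 3 or 4;
separation by value gives, after inversion, type 1 or 2. -/
theorem NoSingleDeletion.isExceptional_of_isTwin (H : NoSingleDeletion π σ)
    (hσ : SimpleOn σ Set.univ) (hn : 4 ≤ n) {x y u : Fin n} (hxy : x ≠ y) (hxu : x ≠ u)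
    (hyu : y ≠ u)
    (ht : IsTwin σ x y u) (hG : IsDoubleDeletion π σ x y) (hG' : IsDoubleDeletion π σ x u) :
    ∃ t, IsExceptional t σ := by
  by_cases h1 : x < y ↔ x < u
  · by_cases h2 : σ x < σ y ↔ σ x < σ u
    · exfalso
      refine exists_not_alike (c := y) hσ hn hyu fun q hqy hqu _ => ⟨?_, Alike.refl ..⟩
      by_cases hq : q = x
      · subst hq; exact ⟨h1, h2⟩
      · exact ht q hq hqy hqu
    · have hσ' : SimpleOn σ⁻¹ Set.univ := by
        have := simpleOn_inv.2 hσ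
        rwa [Set.image_univ_of_surjective σ.surjective] at this
      have hinv : ∀ t, σ⁻¹ = exceptional t n → σ = (exceptional t n)⁻¹ := fun t h => by
        rw [← h, inv_inv]
      rcases H.inv.isExceptional_of_separates hσ' hn (σ.injective.ne hxy) (σ.injective.ne hxu) h2
        ht.inv hG.inv hG'.inv with ⟨-, h, e⟩ | ⟨-, h, e⟩
      · exact ⟨.one, hn, h, (hinv _ e).trans (inv_exceptional_three h)⟩
      · exact ⟨.two, hn, h, (hinv _ e).trans (inv_exceptional_four h)⟩
  · rcases H.isExceptional_of_separates hσ hn hxy hxu h1 ht hG hG' with h | h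
    exacts [⟨_, h⟩, ⟨_, h⟩]

/-- A simple permutation that is not exceptional has, for each simple proper pattern of size at
least `4`, a simple one-point deletion containing that pattern. -/
theorem exists_simpleOn_compl_singleton (hσ : SimpleOn σ Set.univ) (hπ : SimpleOn π Set.univ)
    (h : IsPattern π σ) (hk : 4 ≤ k) (hkn : k < n) (hexc : ∀ t, ¬ IsExceptional t σ) :
    ∃ x, SimpleOn σ {x}ᶜ ∧ ∃ g, IsCopy π σ g ∧ ∀ i, g i ≠ x := by
  by_contra! hcon
  have H : NoSingleDeletion π σ := hcon
  obtain ⟨g, hg⟩ := isPattern_iff.1 h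
  have hinj := hg.strictMono.injective
  obtain ⟨a, b, hab, hs⟩ := exists_simpleOn_compl_pair hσ (Set.range g)
    (hg.simpleOn_range.2 hπ)
    (fun u v => by
      by_contra! hc
      have : (Set.range g).ncard ≤ 2 :=
        (Set.ncard_le_ncard (t := {u, v}) fun w hw => by
          by_cases hwu : w = u
          · exact Or.inl hwu
          · exact Or.inr (hc w hw hwu)).trans (ncard_pair_le u v)
      rw [← Set.image_univ, Set.ncard_image_of_injective _ hinj, Set.ncard_univ,
        Nat.card_fin] at this
      omega)
    (fun e => by
      have := congrArg Set.ncard e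
      rw [← Set.image_univ, Set.ncard_image_of_injective _ hinj, Set.ncard_univ, Set.ncard_univ,
        Nat.card_fin, Nat.card_fin] at this
      omega)
  have hgab : ∀ i, g i ≠ a ∧ g i ≠ b := fun i => by
    simpa using hab ⟨i, rfl⟩
  by_cases hne : a = b
  · subst hne
    obtain ⟨i, hi⟩ := H a (by simpa using hs) g hg
    exact (hgab i).1 hi
  have hG : IsDoubleDeletion π σ a b := ⟨hne, hs, g, hg, hgab⟩
  -- If `a` and `b` both see the rest alike, the rest is a module; otherwise one of them has a twin
  -- and `σ` is exceptional.
  rcases H.corner_or_twin hG with h1 | ⟨u, hua, hub, ht, hG'⟩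
  · rcases H.corner_or_twin hG.symm with h2 | ⟨u, hub, hua, ht, hG'⟩
    · have hmod : IsModuleOn σ Set.univ {a, b}ᶜ := by
        refine ⟨Set.subset_univ _, fun q _ hq y hy z hz => ?_⟩
        simp only [Set.mem_compl_iff, Set.mem_insert_iff, Set.mem_singleton_iff, not_or]
          at hy hz
        replace hq : q = a ∨ q = b := by simpa [or_iff_not_imp_left] using hq
        rcases hq with rfl | rfl
        · exact h2 y hy.2 hy.1 z hz.2 hz.1
        · exact h1 y hy.1 hy.2 z hz.1 hz.2
      rcases hσ _ hmod with h | h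
      · have := hinj (h (hab ⟨⟨0, by omega⟩, rfl⟩) (hab ⟨⟨1, by omega⟩, rfl⟩))
        simp at this
      · exact (h.ge (Set.mem_univ a)) (Or.inl rfl)
    · obtain ⟨t, ht⟩ := H.isExceptional_of_isTwin hσ (by omega) (Ne.symm hne) hub.symm hua.symm ht
        hG.symm hG'
      exact hexc t ht
  · obtain ⟨t, ht⟩ := H.isExceptional_of_isTwin hσ (by omega) hne hua.symm hub.symm ht hG hG'
    exact hexc t ht

end Deletion

/-! ## Simple permutations contain `2413` or `3142` -/

section Split

variable {α : Type*} [LinearOrder α]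

/-- `A` precedes `B`, and all its elements are related to those of `B`. -/
def Precedes (r : α → α → Prop) (A B : Finset α) : Prop :=
  A.Nonempty ∧ B.Nonempty ∧ ∀ a ∈ A, ∀ b ∈ B, a < b ∧ r a b

open Classical in
-- When `p` is related in both ways to elements of `A`, either two of these occur in the order that
-- gives a forbidden pattern with `b` and `p`, or `A` can be cut so that its second part joins `B`.
-- After the cut every element of the smaller `A` is below `p` for `r`, and `p` joins the second
-- block.
theorem exists_precedes_insert {r : α → α → Prop} (htrans : ∀ a b c, r a b → r b c → r a c)
    (htri : ∀ a b, a ≠ b → r a b ∨ r b a) (T : Finset α) {p : α} (hp : ∀ t ∈ T, t < p)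
    (A B : Finset α) (hT : T = A ∪ B) (h : Precedes r A B) :
    (∃ x y b, x < y ∧ y < b ∧ b < p ∧ r y p ∧ r p x ∧ r x b) ∨
      ∃ A' B', insert p T = A' ∪ B' ∧ (Precedes r A' B' ∨ Precedes (flip r) A' B') := by
  obtain ⟨hA, ⟨b, hb⟩, hAB⟩ := h
  have hpA : ∀ a ∈ A, a < p := fun a ha => hp a (by simp [hT, ha])
  by_cases h1 : ∀ a ∈ A, r a p
  · refine Or.inr ⟨A, insert p B, by rw [hT, Finset.union_insert], Or.inl ⟨hA, by simp, ?_⟩⟩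
    intro a ha c hc
    rcases Finset.mem_insert.1 hc with rfl | hc
    exacts [⟨hpA a ha, h1 a ha⟩, hAB a ha c hc]
  push Not at h1
  obtain ⟨x, hx, hxp⟩ := h1
  have hpx : r p x := (htri x p (hpA x hx).ne).resolve_left hxp
  by_cases h2 : ∃ y ∈ A, r y p
  · obtain ⟨y, hy, hyp⟩ := h2
    by_cases h3 : ∃ x ∈ A, ∃ y ∈ A, x < y ∧ r p x ∧ r y p
    · obtain ⟨x, hx, y, hy, hxy, hpx, hyp⟩ := h3
      exact Or.inl ⟨x, y, b, hxy, (hAB y hy b hb).1, hp b (by simp [hT, hb]), hyp, hpx,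
        (hAB x hx b hb).2⟩
    · push Not at h3
      refine exists_precedes_insert htrans htri T hp (A.filter fun a => r a p)
        ((A.filter fun a => ¬ r a p) ∪ B) (by rw [← Finset.union_assoc,
          Finset.filter_union_filter_not_eq, hT]) ⟨⟨y, by simp [hy, hyp]⟩, ⟨x, by simp [hx, hxp]⟩, ?_⟩
      intro a ha c hc
      rw [Finset.mem_filter] at ha
      rcases Finset.mem_union.1 hc with hc | hc
      · rw [Finset.mem_filter] at hc
        have hpc : r p c := (htri c p (hpA c hc.1).ne).resolve_left hc.2
        refine ⟨lt_of_le_of_ne (not_lt.1 fun hca => h3 c hc.1 a ha.1 hca hpc ha.2) ?_,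
          htrans _ _ _ ha.2 hpc⟩
        rintro rfl
        exact hc.2 ha.2
      · exact hAB a ha.1 c hc
  · push Not at h2
    have hpr : ∀ a ∈ A, r p a := fun a ha => (htri a p (hpA a ha).ne).resolve_left (h2 a ha)
    refine Or.inr ⟨T, {p}, by rw [Finset.union_comm]; rfl, Or.inr ⟨⟨x, by simp [hT, hx]⟩, by simp,
      fun t ht q hq => ?_⟩⟩
    obtain rfl := Finset.mem_singleton.1 hq
    refine ⟨hp t ht, ?_⟩
    rw [hT] at ht
    rcases Finset.mem_union.1 ht with ht | ht
    · exact hpr t ht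
    · exact htrans _ _ _ hpx (hAB x hx t ht).2
termination_by A.card
decreasing_by exact Finset.card_lt_card (Finset.filter_ssubset.2 ⟨x, hx, hxp⟩)

end Split

/-! ### Occurrence of 2413 or 3142, and small sizes -/

section Four

variable {n : ℕ} {σ : Equiv.Perm (Fin n)}

theorem isPattern_perm3142 {x y b p : Fin n} (h1 : x < y) (h2 : y < b) (h3 : b < p)
    (h4 : σ y < σ p) (h5 : σ p < σ x) (h6 : σ x < σ b) : IsPattern perm3142 σ := by
  refine isPattern_iff.2 ⟨![x, y, b, p], ?_, ?_⟩
  · simp only [Fin.lt_def] at *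
    intro i j
    fin_cases i <;> fin_cases j <;> simp <;> omega
  · simp only [Fin.lt_def] at *
    intro i j
    fin_cases i <;> fin_cases j <;> simp [perm3142] <;> omega

theorem isPattern_perm2413 {x y b p : Fin n} (h1 : x < y) (h2 : y < b) (h3 : b < p)
    (h4 : σ p < σ y) (h5 : σ x < σ p) (h6 : σ b < σ x) : IsPattern perm2413 σ := by
  refine isPattern_iff.2 ⟨![x, y, b, p], ?_, ?_⟩
  · simp only [Fin.lt_def] at *
    intro i j
    fin_cases i <;> fin_cases j <;> simp <;> omega
  · simp only [Fin.lt_def] at *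
    intro i j
    fin_cases i <;> fin_cases j <;> simp [perm2413] <;> omega

theorem isPattern_four_or_precedes (σ : Equiv.Perm (Fin n)) (S : Finset (Fin n)) :
    2 ≤ S.card → (IsPattern perm2413 σ ∨ IsPattern perm3142 σ) ∨
      ∃ A B, S = A ∪ B ∧ (Precedes (fun a b => σ a < σ b) A B ∨
        Precedes (flip fun a b => σ a < σ b) A B) := by
  induction S using Finset.induction_on_max with
  | empty => simp
  | insert p T hp ih =>
    intro hcard
    have hpT : p ∉ T := fun h => (hp p h).false
    rw [Finset.card_insert_of_notMem hpT] at hcard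
    have htri : ∀ a b : Fin n, a ≠ b → σ a < σ b ∨ σ b < σ a := fun a b h =>
      lt_or_gt_of_ne (σ.injective.ne h)
    by_cases hT : T.card = 1
    · obtain ⟨t, rfl⟩ := Finset.card_eq_one.1 hT
      have htp := hp t (by simp)
      refine Or.inr ⟨{t}, {p}, by rw [Finset.union_comm]; rfl, ?_⟩
      refine (htri t p htp.ne).imp (fun h => ?_) fun h => ?_ <;>
      · refine ⟨by simp, by simp, fun a ha b hb => ?_⟩
        rw [Finset.mem_singleton] at ha hb
        subst ha; subst hb
        exact ⟨htp, h⟩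
    rcases ih (by omega) with h | ⟨A, B, hAB, h | h⟩
    · exact Or.inl h
    · rcases exists_precedes_insert (r := fun a b => σ a < σ b) (fun _ _ _ => lt_trans) htri T hp A B hAB h with
        ⟨x, y, b, h1, h2, h3, h4, h5, h6⟩ | h
      · exact Or.inl (Or.inr (isPattern_perm3142 h1 h2 h3 h4 h5 h6))
      · exact Or.inr h
    · rcases exists_precedes_insert (r := flip fun a b => σ a < σ b)
        (fun _ _ _ h h' => lt_trans h' h)
        (fun a b h => (htri a b h).symm) T hp A B hAB h with
        ⟨x, y, b, h1, h2, h3, h4, h5, h6⟩ | ⟨A, B, hAB, h⟩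
      · exact Or.inl (Or.inl (isPattern_perm2413 h1 h2 h3 h4 h5 h6))
      · exact Or.inr ⟨A, B, hAB, h.symm⟩

theorem isPattern_four_of_simpleOn (hσ : SimpleOn σ Set.univ) (hn : 3 ≤ n) :
    IsPattern perm2413 σ ∨ IsPattern perm3142 σ := by
  refine (isPattern_four_or_precedes σ Finset.univ (by simp; omega)).resolve_right ?_
  rintro ⟨A, B, hAB, h⟩
  have hmem : ∀ x, x ∈ A ∨ x ∈ B := fun x => by
    rw [← Finset.mem_union, ← hAB]; exact Finset.mem_univ x
  obtain ⟨⟨a, ha⟩, ⟨b, hb⟩⟩ : A.Nonempty ∧ B.Nonempty := by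
    rcases h with h | h <;> exact ⟨h.1, h.2.1⟩
  have hlt : ∀ a ∈ A, ∀ b ∈ B, a < b := by
    rcases h with h | h <;> exact fun a ha b hb => (h.2.2 a ha b hb).1
  have hval : (∀ a ∈ A, ∀ b ∈ B, σ a < σ b) ∨ ∀ a ∈ A, ∀ b ∈ B, σ b < σ a := by
    refine h.imp (fun h => ?_) fun h => ?_ <;> exact fun a ha b hb => (h.2.2 a ha b hb).2
  -- Both blocks of a sum or skew sum are modules; being proper, they would have at most one point
  -- each, against `3 ≤ n`.
  have hA : IsModuleOn σ Set.univ A := by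
    refine ⟨Set.subset_univ _, fun q _ hq y hy z hz => ?_⟩
    have hqB := (hmem q).resolve_left hq
    refine ⟨iff_of_false (hlt y hy q hqB).not_gt (hlt z hz q hqB).not_gt, ?_⟩
    rcases hval with h | h
    · exact iff_of_false (h y hy q hqB).not_gt (h z hz q hqB).not_gt
    · exact iff_of_true (h y hy q hqB) (h z hz q hqB)
  have hB : IsModuleOn σ Set.univ B := by
    refine ⟨Set.subset_univ _, fun q _ hq y hy z hz => ?_⟩
    have hqA := (hmem q).resolve_right hq
    refine ⟨iff_of_true (hlt q hqA y hy) (hlt q hqA z hz), ?_⟩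
    rcases hval with h | h
    · exact iff_of_true (h q hqA y hy) (h q hqA z hz)
    · exact iff_of_false (h q hqA y hy).not_gt (h q hqA z hz).not_gt
  rcases hσ _ hA with h1 | h1
  · rcases hσ _ hB with h2 | h2
    · have h3 := Finset.card_union_le A B
      rw [← hAB, Finset.card_univ, Fintype.card_fin] at h3
      have h4 := Finset.card_le_one_iff_subsingleton_coe.2 ((Set.subsingleton_coe _).2 h1)
      have h5 := Finset.card_le_one_iff_subsingleton_coe.2 ((Set.subsingleton_coe _).2 h2)
      omega
    · exact (hlt a ha a (h2.ge (Set.mem_univ a))).false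
  · exact (hlt b (h1.ge (Set.mem_univ b)) b hb).false

theorem four_le_of_simpleOn (hσ : SimpleOn σ Set.univ) (hn : 3 ≤ n) : 4 ≤ n := by
  rcases isPattern_four_of_simpleOn hσ hn with h | h <;> exact h.le

theorem isSimple_perm_two (σ : Equiv.Perm (Fin 2)) : IsSimple σ := by
  refine ⟨by norm_num, fun a b h => ?_⟩
  have := h.1
  fin_cases a <;> fin_cases b <;> simp_all
  decide

end Four

/-! ## Exceptional permutations -/

section Exceptional

variable {k l n : ℕ} {π : Equiv.Perm (Fin k)} {τ : Equiv.Perm (Fin l)} {σ : Equiv.Perm (Fin n)}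

/-- A module with two points contains two adjacent positions. Their values lie in different halves,
and the values at the two ends of the word, the middle ones, lie between them. So both ends belong
to the module. -/
theorem exceptional_simpleOn_of_alternating {t : ExcType} (ht : t = .three ∨ t = .four)
    (hn : 4 ≤ n) (h : n % 2 = 0) : SimpleOn (exceptional t n) Set.univ := by
  intro M hM
  by_contra! hcon
  obtain ⟨hns, hne⟩ := hcon
  obtain ⟨y, hy, z, hz, hyz⟩ := hns.exists_lt
  rw [Fin.lt_def] at hyz
  have hw := hM.mem_of_between (x := ⟨y + 1, by omega⟩) hy hz (by simp [Fin.le_def])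
    (by simp only [Fin.le_def]; omega)
  have key : ∀ x : Fin n, (x : ℕ) = 0 ∨ (x : ℕ) + 1 = n → x ∈ M := by
    intro x hx
    by_cases hp : (y : ℕ) % 2 = 0
    · rcases ht with rfl | rfl
      · refine hM.mem_of_value_between hw hy ?_ ?_ <;>
        · simp only [Fin.le_def, exceptional_apply _ h, excValue]
          split_ifs <;> omega
      · refine hM.mem_of_value_between hy hw ?_ ?_ <;>
        · simp only [Fin.le_def, exceptional_apply _ h, excValue]
          split_ifs <;> omega
    · rcases ht with rfl | rfl
      · refine hM.mem_of_value_between hy hw ?_ ?_ <;>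
        · simp only [Fin.le_def, exceptional_apply _ h, excValue]
          split_ifs <;> omega
      · refine hM.mem_of_value_between hw hy ?_ ?_ <;>
        · simp only [Fin.le_def, exceptional_apply _ h, excValue]
          split_ifs <;> omega
  refine hne (Set.eq_univ_of_forall fun x => ?_)
  exact hM.mem_of_between (key ⟨0, by omega⟩ (Or.inl rfl))
    (key ⟨n - 1, by omega⟩ (Or.inr (by simp; omega))) (by simp [Fin.le_def])
    (by simp only [Fin.le_def]; omega)

theorem exceptional_isSimple (t : ExcType) (hn : 4 ≤ n) (h : n % 2 = 0) :
    IsSimple (exceptional t n) := by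
  have key : ∀ {t : ExcType}, t = .three ∨ t = .four → IsSimple (exceptional t n) := fun ht =>
    isSimple_iff.2 ⟨by omega, exceptional_simpleOn_of_alternating ht hn h⟩
  cases t with
  | one => exact inv_exceptional_three h ▸ (key (Or.inl rfl)).inv
  | two => exact inv_exceptional_four h ▸ (key (Or.inr rfl)).inv
  | three => exact key (Or.inl rfl)
  | four => exact key (Or.inr rfl)

theorem IsCopy.isPattern_of_range_subset {f : Fin l → Fin n} {g : Fin k → Fin n}
    (hf : IsCopy τ σ f) (hg : IsCopy π σ g) (h : ∀ i, ∃ j, f j = g i) : IsPattern π τ := by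
  choose e he using h
  refine isPattern_iff.2 ⟨e, fun a b => ?_, fun a b => ?_⟩
  · rw [hf.1, he, he, hg.1]
  · rw [hf.2, he, he, hg.2]

/-- An occurrence avoiding `x` cannot use both twins, which would form a module of `π`; if it uses
`y`, then `y` is exchanged for `u`. -/
theorem IsTwin.exists_isCopy_of_simpleOn {x y u : Fin n} (h : IsTwin σ x y u) (hyx : y ≠ x)
    (hux : u ≠ x) (hyu : y ≠ u) (hπ : SimpleOn π Set.univ) (hk : 3 ≤ k) {g : Fin k → Fin n}
    (hg : IsCopy π σ g) (hx : ∀ i, g i ≠ x) :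
    ∃ g, IsCopy π σ g ∧ ∀ i, g i ≠ x ∧ g i ≠ y := by
  by_cases hy : ∃ i, g i = y
  · by_cases hu : ∃ j, g j = u
    · exfalso
      obtain ⟨i, rfl⟩ := hy
      obtain ⟨j, rfl⟩ := hu
      have hmod : IsModuleOn π Set.univ {i, j} := by
        refine ⟨Set.subset_univ _, fun q _ hq => ?_⟩
        simp only [Set.mem_insert_iff, Set.mem_singleton_iff, not_or] at hq
        have h1 := h (g q) (hx q) (hg.strictMono.injective.ne hq.1)
          (hg.strictMono.injective.ne hq.2)
        have : Alike π q i j := by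
          unfold Alike at h1 ⊢
          rwa [hg.2, hg.2, hg.1, hg.1]
        rintro _ (rfl | rfl) _ (rfl | rfl)
        exacts [Alike.refl .., this, this.symm, Alike.refl ..]
      rcases hπ _ hmod with h | h
      · exact hyu (congrArg g (h (Or.inl rfl) (Or.inr rfl)))
      · have h1 := congrArg Set.ncard h
        have h2 := ncard_pair_le i j
        rw [Set.ncard_univ, Nat.card_fin] at h1
        omega
    · push Not at hu
      exact h.symm.exists_isCopy hux hyx hg fun i => ⟨hx i, hu i⟩
  · push Not at hy
    exact ⟨g, hg, fun i => ⟨hx i, hy i⟩⟩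

theorem IsCopy.ne_of_corner {x y : Fin n}
    (h : ∀ p, p ≠ x → p ≠ y → ∀ q, q ≠ x → q ≠ y → Alike σ y p q)
    (hπ : SimpleOn π Set.univ) (hk : 3 ≤ k) {g : Fin k → Fin n}
    (hg : IsCopy π σ g) (hx : ∀ i, g i ≠ x) (i : Fin k) : g i ≠ y := by
  rintro rfl
  have hmod : IsModuleOn π Set.univ {i}ᶜ := by
    refine ⟨Set.subset_univ _, fun q _ hq a ha b hb => ?_⟩
    obtain rfl : q = i := by simpa using hq
    have h1 := h (g a) (hx a) (hg.strictMono.injective.ne ha) (g b) (hx b)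
      (hg.strictMono.injective.ne hb)
    unfold Alike at h1 ⊢
    rwa [hg.2, hg.2, hg.1, hg.1]
  rcases hπ _ hmod with h | h
  · have h1 := Set.ncard_le_one_iff_subsingleton.2 h
    rw [Set.ncard_compl, Set.ncard_singleton, Nat.card_fin] at h1
    omega
  · exact (h.ge (Set.mem_univ i)) rfl

/-- Omitting any two adjacent positions `p, p + 1` from type 3 or 4 leaves the preceding permutation
of the type. -/
theorem isCopy_exceptional {t : ExcType} (ht : t = .three ∨ t = .four) (h : n % 2 = 0) {p : ℕ}
    (hp : p + 2 ≤ n + 2) :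
    IsCopy (exceptional t n) (exceptional t (n + 2))
      (fun j => if (j : ℕ) < p then ⟨j, by omega⟩ else ⟨j + 2, by omega⟩) := by
  constructor
  · intro i j
    simp only [Fin.lt_def]
    split_ifs <;> simp only <;> omega
  · intro i j
    simp only [Fin.lt_def, exceptional_apply _ h,
      exceptional_apply _ (show (n + 2) % 2 = 0 by omega)]
    rcases ht with rfl | rfl
    · simp only [excValue]
      by_cases h1 : (i : ℕ) < p <;> by_cases h2 : (j : ℕ) < p <;> simp only [h1, h2, if_true, if_false] <;>
        split_ifs <;> omega
    · simp only [excValue]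
      by_cases h1 : (i : ℕ) < p <;> by_cases h2 : (j : ℕ) < p <;> simp only [h1, h2, if_true, if_false] <;>
        split_ifs <;> omega

theorem isTwin_exceptional {t : ExcType} (ht : t = .three ∨ t = .four) (h : n % 2 = 0)
    {x y u : Fin n} (hy : (y : ℕ) + 1 = x) (hu : (x : ℕ) + 1 = u) :
    IsTwin (exceptional t n) x y u := by
  intro q hqx hqy hqu
  have h1 := Fin.val_ne_of_ne hqx
  have h2 := Fin.val_ne_of_ne hqy
  have h3 := Fin.val_ne_of_ne hqu
  simp only [Alike, Fin.lt_def, exceptional_apply _ h]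
  refine ⟨by omega, ?_⟩
  rcases ht with rfl | rfl <;> simp only [excValue] <;> split_ifs <;> omega

theorem corner_exceptional {t : ExcType} (ht : t = .three ∨ t = .four) (h : n % 2 = 0)
    {x y : Fin n} (hxy : (x : ℕ) = 0 ∧ (y : ℕ) = 1 ∨ (x : ℕ) + 1 = n ∧ (y : ℕ) + 2 = n) :
    ∀ p, p ≠ x → p ≠ y → ∀ q, q ≠ x → q ≠ y → Alike (exceptional t n) y p q := by
  have key : ∀ p, p ≠ x → p ≠ y → (y < p ↔ (y : ℕ) = 1 ∧ (x : ℕ) = 0) ∧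
      (exceptional t n y < exceptional t n p ↔
        (t = .three ∧ (x : ℕ) = 0 ∨ t = .four ∧ (x : ℕ) ≠ 0)) := by
    intro p hpx hpy
    have h1 := Fin.val_ne_of_ne hpx
    have h2 := Fin.val_ne_of_ne hpy
    simp only [Fin.lt_def, exceptional_apply _ h]
    refine ⟨by omega, ?_⟩
    rcases ht with rfl | rfl <;> simp only [excValue] <;> split_ifs <;> simp <;> omega
  intro p hpx hpy q hqx hqy
  exact ⟨(key p hpx hpy).1.trans (key q hqx hqy).1.symm,
    (key p hpx hpy).2.trans (key q hqx hqy).2.symm⟩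

/-- An occurrence of `π` misses some `x` and can be made to miss a neighbour of `x` too: the
neighbours of an inner point are twins, and the neighbour of an end point becomes a corner. It then
lives in the preceding exceptional permutation. -/
theorem isPattern_exceptional_of_alternating {t : ExcType} (ht : t = .three ∨ t = .four)
    (h : n % 2 = 0) (hπ : SimpleOn π Set.univ) (hk : 3 ≤ k) (hkn : k < n + 2)
    (hp : IsPattern π (exceptional t (n + 2))) : IsPattern π (exceptional t n) := by
  have h' : (n + 2) % 2 = 0 := by omega
  obtain ⟨g, hg⟩ := isPattern_iff.1 hp
  obtain ⟨x, hx⟩ : ∃ x, ∀ i, g i ≠ x := by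
    by_contra! hcon
    have := Fintype.card_le_of_surjective g hcon
    simp at this
    omega
  have key : ∀ y : Fin (n + 2), ((y : ℕ) + 1 = x ∨ (x : ℕ) + 1 = y) →
      (∃ g, IsCopy π (exceptional t (n + 2)) g ∧ ∀ i, g i ≠ x ∧ g i ≠ y) →
      IsPattern π (exceptional t n) := by
    rintro y hy ⟨g, hg, hgxy⟩
    refine (isCopy_exceptional ht h (p := min (x : ℕ) y) (by omega)).isPattern_of_range_subset hg
      fun i => ?_
    have h1 := Fin.val_ne_of_ne (hgxy i).1
    have h2 := Fin.val_ne_of_ne (hgxy i).2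
    by_cases hlt : (g i : ℕ) < min (x : ℕ) y
    · refine ⟨⟨g i, by omega⟩, ?_⟩
      simp only [hlt, if_true]
    · refine ⟨⟨g i - 2, by omega⟩, ?_⟩
      rw [if_neg (by simp only; omega)]
      ext
      simp only
      omega
  have hn : 2 ≤ n := by omega
  by_cases hx0 : (x : ℕ) = 0
  · refine key ⟨1, by omega⟩ (Or.inr (by simp [hx0])) ⟨g, hg, fun i => ⟨hx i, ?_⟩⟩
    exact hg.ne_of_corner (corner_exceptional ht h' (Or.inl ⟨hx0, rfl⟩)) hπ hk hx i
  by_cases hx1 : (x : ℕ) + 1 = n + 2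
  · refine key ⟨n, by omega⟩ (Or.inl (by simp only; omega)) ⟨g, hg, fun i => ⟨hx i, ?_⟩⟩
    exact hg.ne_of_corner (corner_exceptional ht h' (Or.inr ⟨hx1, rfl⟩)) hπ hk hx i
  · refine key ⟨x - 1, by omega⟩ (Or.inl (by simp only; omega)) ?_
    exact (isTwin_exceptional ht h' (u := ⟨x + 1, by omega⟩) (by simp only; omega)
      rfl).exists_isCopy_of_simpleOn (by simp only [ne_eq, Fin.ext_iff]; omega)
      (by simp only [ne_eq, Fin.ext_iff]; omega) (by simp only [ne_eq, Fin.ext_iff]; omega) hπ hk hg hx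

/-- The simple proper patterns of an exceptional permutation are patterns of the preceding
exceptional permutation of the same type. -/
theorem isPattern_exceptional (t : ExcType) (h : n % 2 = 0) (hπ : IsSimple π) (hk : 3 ≤ k)
    (hkn : k < n + 2) (hp : IsPattern π (exceptional t (n + 2))) :
    IsPattern π (exceptional t n) := by
  have h' : (n + 2) % 2 = 0 := by omega
  have hs := (isSimple_iff.1 hπ).2
  have hs' := (isSimple_iff.1 hπ.inv).2
  cases t with
  | one =>
    rw [← inv_exceptional_three h'] at hp
    have := (isPattern_exceptional_of_alternating (Or.inl rfl) h hs' hk hkn hp.inv).inv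
    rwa [inv_inv, inv_exceptional_three h] at this
  | two =>
    rw [← inv_exceptional_four h'] at hp
    have := (isPattern_exceptional_of_alternating (Or.inr rfl) h hs' hk hkn hp.inv).inv
    rwa [inv_inv, inv_exceptional_four h] at this
  | three => exact isPattern_exceptional_of_alternating (Or.inl rfl) h hs hk hkn hp
  | four => exact isPattern_exceptional_of_alternating (Or.inr rfl) h hs hk hkn hp

theorem isPattern_exceptional_exceptional (t : ExcType) (h : n % 2 = 0) :
    IsPattern (exceptional t n) (exceptional t (n + 2)) := by
  have key : ∀ {t : ExcType}, t = .three ∨ t = .four →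
      IsPattern (exceptional t n) (exceptional t (n + 2)) := fun ht =>
    isPattern_iff.2 ⟨_, isCopy_exceptional ht h (p := 0) (by omega)⟩
  have h' : (n + 2) % 2 = 0 := by omega
  cases t with
  | one =>
    rw [← inv_exceptional_three h, ← inv_exceptional_three h']
    exact (key (Or.inl rfl)).inv
  | two =>
    rw [← inv_exceptional_four h, ← inv_exceptional_four h']
    exact (key (Or.inr rfl)).inv
  | three => exact key (Or.inl rfl)
  | four => exact key (Or.inr rfl)

theorem exceptional_one_four : exceptional .one 4 = perm2413 := by
  ext j
  rw [exceptional_apply _ (by norm_num)]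
  fin_cases j <;> rfl

theorem exceptional_two_four : exceptional .two 4 = perm3142 := by
  ext j
  rw [exceptional_apply _ (by norm_num)]
  fin_cases j <;> rfl

theorem isSimple_perm2413 : IsSimple perm2413 :=
  exceptional_one_four ▸ exceptional_isSimple .one le_rfl rfl

theorem isSimple_perm3142 : IsSimple perm3142 :=
  exceptional_two_four ▸ exceptional_isSimple .two le_rfl rfl

end Exceptional

/-! ## Execution of programs -/

section Exec

variable {α β γ : Type} (B : Set (Σ n : ℕ, Equiv.Perm (Fin n)))

theorem Prog.exec_andThen (answer : Test → Bool) (p : Prog α) (f : α → Prog β) :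
    (p.andThen f).exec answer = (((f (p.exec answer).1).exec answer).1,
      (p.exec answer).2 ++ ((f (p.exec answer).1).exec answer).2) := by
  induction p with
  | ret a => rfl
  | ask t next ih => simp [Prog.andThen, Prog.exec, ih]

theorem Prog.run_bind (p : Prog α) (f : α → Prog β) :
    (p >>= f).run B = (((f (p.run B).1).run B).1, (p.run B).2 ++ ((f (p.run B).1).run B).2) :=
  Prog.exec_andThen _ p f

theorem Prog.run_pure (a : α) : (pure a : Prog α).run B = (a, []) := rfl

open Classical in
theorem run_test (t : Test) : (test t).run B = (decide (t.Holds B), [t]) := rfl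

variable {B} in
theorem run_test_ite_of_holds {t : Test} (h : t.Holds B) (p q : Prog α) :
    ((test t >>= fun b => if b = true then p else q).run B).1 = (p.run B).1 := by
  simp [Prog.run_bind, run_test, h]

variable {B} in
theorem run_test_ite_of_not_holds {t : Test} (h : ¬ t.Holds B) (p q : Prog α) :
    ((test t >>= fun b => if b = true then p else q).run B).1 = (q.run B).1 := by
  simp [Prog.run_bind, run_test, h]

/-- As far as results are concerned, a loop is a pure fold, so membership in the final list can be
read off with `foldl_iff_and` and `foldl_iff_or`. -/
theorem run_foldlM (f : β → α → Prog β) (l : List α) (b : β) :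
    ((l.foldlM f b).run B).1 = l.foldl (fun b a => ((f b a).run B).1) b := by
  induction l generalizing b with
  | nil => rfl
  | cons a l ih => rw [List.foldlM_cons, Prog.run_bind, ih, List.foldl_cons]

theorem foldl_iff_and {f : β → α → β} {P : β → Prop} {Q : α → Prop}
    (h : ∀ b a, P (f b a) ↔ P b ∧ Q a) (l : List α) (b : β) :
    P (l.foldl f b) ↔ P b ∧ ∀ a ∈ l, Q a := by
  induction l generalizing b with
  | nil => simp
  | cons a l ih => rw [List.foldl_cons, ih, h, List.forall_mem_cons, and_assoc]

theorem foldl_iff_or {f : β → α → β} {P : β → Prop} {Q : α → Prop}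
    (h : ∀ b a, P (f b a) ↔ P b ∨ Q a) (l : List α) (b : β) :
    P (l.foldl f b) ↔ P b ∨ ∃ a ∈ l, Q a := by
  induction l generalizing b with
  | nil => simp
  | cons a l ih => rw [List.foldl_cons, ih, h, List.exists_mem_cons_iff, or_assoc]

/-- All tests asked by the program are different from pattern-involvement tests. -/
def AsksNoInvolvement (p : Prog α) : Prop := ∀ t ∈ (p.run B).2, ¬ t.IsInvolvement

variable {B}

theorem AsksNoInvolvement.pure (a : α) : AsksNoInvolvement B (pure a : Prog α) := by
  simp [AsksNoInvolvement, Prog.run_pure]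

theorem AsksNoInvolvement.test {t : Test} (h : ¬ t.IsInvolvement) :
    AsksNoInvolvement B (test t) := by
  simpa [AsksNoInvolvement, run_test] using h

theorem AsksNoInvolvement.bind {p : Prog α} {f : α → Prog β} (hp : AsksNoInvolvement B p)
    (hf : ∀ a, AsksNoInvolvement B (f a)) : AsksNoInvolvement B (p >>= f) := by
  intro t ht
  rw [Prog.run_bind, List.mem_append] at ht
  exact ht.elim (hp t) (hf _ t)

theorem AsksNoInvolvement.ite {c : Prop} [Decidable c] {p q : Prog α}
    (hp : AsksNoInvolvement B p) (hq : AsksNoInvolvement B q) :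
    AsksNoInvolvement B (if c then p else q) := by
  split_ifs <;> assumption

theorem AsksNoInvolvement.foldlM {f : β → α → Prog β} (h : ∀ b a, AsksNoInvolvement B (f b a))
    (l : List α) (b : β) : AsksNoInvolvement B (l.foldlM f b) := by
  induction l generalizing b with
  | nil => exact .pure b
  | cons a l ih => rw [List.foldlM_cons]; exact (h b a).bind ih

end Exec

/-! ## The parts of the algorithm -/

section Parts

variable (B : Set (Σ n : ℕ, Equiv.Perm (Fin n)))

theorem asksNoInvolvement_initialState : AsksNoInvolvement B initialState :=
  (AsksNoInvolvement.foldlM (fun _ _ => (AsksNoInvolvement.test (by simp [Test.IsInvolvement])).bind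
    fun _ => .ite (.pure _) (.pure _)) _ _).bind fun _ => .pure _

variable {m : ℕ} (prev : List (Equiv.Perm (Fin (m + 1)))) (acc : List (Equiv.Perm (Fin (m + 2))))

theorem asksNoInvolvement_deletionsOk (σ : Equiv.Perm (Fin (m + 2))) :
    AsksNoInvolvement B (deletionsOk prev σ) :=
  .foldlM (fun _ _ => (AsksNoInvolvement.test (by simp [Test.IsInvolvement])).bind fun _ =>
    .ite ((AsksNoInvolvement.test (by simp [Test.IsInvolvement])).bind fun _ =>
      .ite (.pure _) (.pure _)) (.pure _)) _ _

theorem asksNoInvolvement_tryCandidate (σ : Equiv.Perm (Fin (m + 2))) :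
    AsksNoInvolvement B (tryCandidate prev acc σ) :=
  (AsksNoInvolvement.test (by simp [Test.IsInvolvement])).bind fun _ => .ite (.pure _)
    ((asksNoInvolvement_deletionsOk B prev σ).bind fun _ => .ite (.pure _) (.pure _))

theorem asksNoInvolvement_insertionPhase : AsksNoInvolvement B (insertionPhase prev acc) :=
  .foldlM (fun _ _ => .foldlM (fun _ _ => .foldlM (fun acc _ =>
    (AsksNoInvolvement.test (by simp [Test.IsInvolvement])).bind fun _ =>
      .ite (asksNoInvolvement_tryCandidate B prev acc _) (.pure _)) _ _) _ _) _ _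

theorem asksNoInvolvement_exceptionalPhase (prev₂ : List (Equiv.Perm (Fin m))) :
    AsksNoInvolvement B (exceptionalPhase prev₂ acc) :=
  .foldlM (fun _ _ => .foldlM (fun _ _ =>
    (AsksNoInvolvement.test (by simp [Test.IsInvolvement])).bind fun _ =>
      .ite ((AsksNoInvolvement.test (by simp [Test.IsInvolvement])).bind fun _ =>
        .ite (.pure _) (.pure _)) (.pure _)) _ _) _ _

theorem asksNoInvolvement_algorithm (passes : ℕ) : AsksNoInvolvement B (algorithm passes) := by
  induction passes with
  | zero => exact asksNoInvolvement_initialState B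
  | succ k ih =>
    exact ih.bind fun s => .ite ((asksNoInvolvement_insertionPhase B _ _).bind fun _ =>
      (asksNoInvolvement_exceptionalPhase B _ _).bind fun _ => .pure _) (.pure _)

/-- All simple one-point deletions of `σ` are in `prev`. -/
def DeletionsIn (σ : Equiv.Perm (Fin (m + 2))) : Prop :=
  ∀ i, IsSimple (deletePoint σ i) → deletePoint σ i ∈ prev

theorem run_deletionsOk (σ : Equiv.Perm (Fin (m + 2))) :
    ((deletionsOk prev σ).run B).1 = true ↔ DeletionsIn prev σ := by
  classical
  rw [deletionsOk, run_foldlM, foldl_iff_and (P := fun b => b = true)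
    (Q := fun i => IsSimple (deletePoint σ i) → deletePoint σ i ∈ prev)]
  · simp [DeletionsIn]
  · intro b i
    dsimp only
    by_cases h1 : IsSimple (deletePoint σ i)
    · rw [run_test_ite_of_holds (t := .simple _) h1]
      by_cases h2 : deletePoint σ i ∈ prev
      · rw [run_test_ite_of_holds (t := .mem _ _) h2]
        simp [h2, Prog.run_pure]
      · rw [run_test_ite_of_not_holds (t := .mem _ _) h2]
        simp [h1, h2, Prog.run_pure]
    · rw [run_test_ite_of_not_holds (t := .simple _) h1]
      simp [h1, Prog.run_pure]

theorem mem_run_tryCandidate (σ ρ : Equiv.Perm (Fin (m + 2))) :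
    ρ ∈ ((tryCandidate prev acc σ).run B).1 ↔
      ρ ∈ acc ∨ ρ = σ ∧ ⟨m + 2, ρ⟩ ∉ B ∧ DeletionsIn prev ρ := by
  classical
  rw [tryCandidate]
  by_cases h1 : (⟨m + 2, σ⟩ : Σ n : ℕ, Equiv.Perm (Fin n)) ∈ B
  · rw [run_test_ite_of_holds (t := .memBasis _) h1, Prog.run_pure]
    refine ⟨Or.inl, fun h => h.resolve_right ?_⟩
    rintro ⟨rfl, h, -⟩
    exact h h1
  · rw [run_test_ite_of_not_holds (t := .memBasis _) h1, Prog.run_bind]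
    by_cases h2 : ((deletionsOk prev σ).run B).1 = true
    · rw [if_pos h2, Prog.run_pure, List.mem_insert_iff, or_comm]
      refine or_congr_right ⟨?_, fun h => h.1⟩
      rintro rfl
      exact ⟨rfl, h1, (run_deletionsOk B prev ρ).1 h2⟩
    · rw [if_neg h2, Prog.run_pure]
      refine ⟨Or.inl, fun h => h.resolve_right ?_⟩
      rintro ⟨rfl, -, h⟩
      exact h2 ((run_deletionsOk B prev ρ).2 h)

theorem mem_run_insertionPhase (ρ : Equiv.Perm (Fin (m + 2))) :
    ρ ∈ ((insertionPhase prev acc).run B).1 ↔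
      ρ ∈ acc ∨ ∃ π ∈ prev, ∃ i v, ρ = insertPoint π i v ∧ IsSimple ρ ∧ ⟨m + 2, ρ⟩ ∉ B ∧
        DeletionsIn prev ρ := by
  classical
  rw [insertionPhase, run_foldlM]
  refine foldl_iff_or (P := fun acc => ρ ∈ acc) (fun acc π => ?_) _ _
  rw [run_foldlM, foldl_iff_or (P := fun acc => ρ ∈ acc)
    (Q := fun i => ∃ v, ρ = insertPoint π i v ∧ IsSimple ρ ∧ ⟨m + 2, ρ⟩ ∉ B ∧
        DeletionsIn prev ρ)]
  · simp
  intro acc i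
  rw [run_foldlM, foldl_iff_or (P := fun acc => ρ ∈ acc)
    (Q := fun v => ρ = insertPoint π i v ∧ IsSimple ρ ∧ ⟨m + 2, ρ⟩ ∉ B ∧
        DeletionsIn prev ρ)]
  · simp
  intro acc v
  dsimp only
  by_cases h : IsSimple (insertPoint π i v)
  · rw [run_test_ite_of_holds (t := .simple _) h, mem_run_tryCandidate]
    refine or_congr_right (and_congr_right ?_)
    rintro rfl
    simp [h]
  · rw [run_test_ite_of_not_holds (t := .simple _) h, Prog.run_pure]
    refine ⟨Or.inl, fun h' => h'.resolve_right ?_⟩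
    rintro ⟨rfl, h', -⟩
    exact h h'

theorem mem_run_exceptionalPhase (prev₂ : List (Equiv.Perm (Fin m)))
    (ρ : Equiv.Perm (Fin (m + 2))) :
    ρ ∈ ((exceptionalPhase prev₂ acc).run B).1 ↔
      ρ ∈ acc ∨ ∃ π ∈ prev₂, ∃ t, IsExceptional t π ∧ ρ = exceptional t (m + 2) ∧
        ⟨m + 2, ρ⟩ ∉ B := by
  classical
  rw [exceptionalPhase, run_foldlM]
  refine foldl_iff_or (P := fun acc => ρ ∈ acc) (fun acc π => ?_) _ _
  rw [run_foldlM, foldl_iff_or (P := fun acc => ρ ∈ acc)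
    (Q := fun t => IsExceptional t π ∧ ρ = exceptional t (m + 2) ∧ ⟨m + 2, ρ⟩ ∉ B)]
  · refine or_congr_right ⟨fun ⟨t, _, h⟩ => ⟨t, h⟩, fun ⟨t, h⟩ => ⟨t, ?_, h⟩⟩
    cases t <;> simp
  intro acc t
  dsimp only
  by_cases h : IsExceptional t π
  · rw [run_test_ite_of_holds (t := .exceptional _ _) h]
    by_cases h' : (⟨m + 2, exceptional t (m + 2)⟩ : Σ n : ℕ, Equiv.Perm (Fin n)) ∈ B
    · rw [run_test_ite_of_holds (t := .memBasis _) h', Prog.run_pure]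
      refine ⟨Or.inl, fun h => h.resolve_right ?_⟩
      rintro ⟨-, rfl, h⟩
      exact h h'
    · rw [run_test_ite_of_not_holds (t := .memBasis _) h', Prog.run_pure, List.mem_insert_iff, or_comm]
      refine or_congr_right ⟨?_, fun h => h.2.1⟩
      rintro rfl
      exact ⟨h, rfl, h'⟩
  · rw [run_test_ite_of_not_holds (t := .exceptional _ _) h, Prog.run_pure]
    exact ⟨Or.inl, fun h' => h'.resolve_right fun h' => h h'.1⟩

end Parts

/-! ## Correctness -/

section Correctness

variable {B : Set (Σ n : ℕ, Equiv.Perm (Fin n))}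

theorem four_le_of_mem_basis (hsimple : ∀ β ∈ B, IsSimple β.2) (h1 : ⟨1, 1⟩ ∉ B)
    (h12 : ⟨2, perm12⟩ ∉ B) (h21 : ⟨2, perm21⟩ ∉ B) (β : Σ n : ℕ, Equiv.Perm (Fin n))
    (hβ : β ∈ B) : 4 ≤ β.1 := by
  obtain ⟨n, σ⟩ := β
  obtain ⟨hn, hs⟩ := isSimple_iff.1 (hsimple _ hβ)
  obtain rfl | rfl | h3 : n = 1 ∨ n = 2 ∨ 3 ≤ n := by simp only at hn; omega
  · obtain rfl : σ = 1 := Subsingleton.elim _ _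
    exact absurd hβ h1
  · have : ∀ σ : Equiv.Perm (Fin 2), σ = perm12 ∨ σ = perm21 := by decide
    rcases this σ with rfl | rfl
    exacts [absurd hβ h12, absurd hβ h21]
  · exact four_le_of_simpleOn hs h3

theorem mem_av_of_isPattern {k n : ℕ} {π : Equiv.Perm (Fin k)} {σ : Equiv.Perm (Fin n)}
    (hσ : (⟨n, σ⟩ : Σ n : ℕ, Equiv.Perm (Fin n)) ∈ Av B) (h : IsPattern π σ) (hk : 1 ≤ k) :
    (⟨k, π⟩ : Σ n : ℕ, Equiv.Perm (Fin n)) ∈ Av B :=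
  ⟨hk, fun β hβ hβπ => hσ.2 β hβ (hβπ.trans h)⟩

theorem notMem_basis_of_mem_av {n : ℕ} {σ : Equiv.Perm (Fin n)}
    (hσ : (⟨n, σ⟩ : Σ n : ℕ, Equiv.Perm (Fin n)) ∈ Av B) :
    (⟨n, σ⟩ : Σ n : ℕ, Equiv.Perm (Fin n)) ∉ B := fun h => hσ.2 _ h (.refl σ)

/-- The membership test in `B` leaves only proper involvement to be excluded. -/
theorem lt_of_isPattern_of_notMem {n : ℕ} {σ : Equiv.Perm (Fin n)}
    (hσ : (⟨n, σ⟩ : Σ n : ℕ, Equiv.Perm (Fin n)) ∉ B) {β : Σ n : ℕ, Equiv.Perm (Fin n)}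
    (hβ : β ∈ B) (h : IsPattern β.2 σ) : β.1 < n := by
  obtain ⟨k, β⟩ := β
  refine lt_of_le_of_ne h.le ?_
  rintro rfl
  have he : β = σ := IsPattern.eq h
  exact hσ (he ▸ hβ)

theorem isSimple_deletePoint_iff {n : ℕ} (hn : 1 ≤ n) {σ : Equiv.Perm (Fin (n + 1))}
    {i : Fin (n + 1)} : IsSimple (deletePoint σ i) ↔ SimpleOn σ {i}ᶜ := by
  rw [isSimple_iff, simpleOn_deletePoint]
  exact and_iff_right hn

theorem exists_isSimple_deletePoint {n : ℕ} (hn : 4 ≤ n) {σ : Equiv.Perm (Fin (n + 1))}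
    (hσ : IsSimple σ) (hexc : ∀ t, ¬ IsExceptional t σ) : ∃ i, IsSimple (deletePoint σ i) := by
  obtain ⟨-, hs⟩ := isSimple_iff.1 hσ
  rcases isPattern_four_of_simpleOn hs (by omega) with h | h
  · obtain ⟨x, hx, -⟩ := exists_simpleOn_compl_singleton hs (isSimple_iff.1 isSimple_perm2413).2 h
      le_rfl (by omega) hexc
    exact ⟨x, (isSimple_deletePoint_iff (by omega)).2 hx⟩
  · obtain ⟨x, hx, -⟩ := exists_simpleOn_compl_singleton hs (isSimple_iff.1 isSimple_perm3142).2 h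
      le_rfl (by omega) hexc
    exact ⟨x, (isSimple_deletePoint_iff (by omega)).2 hx⟩

/-- `l` lists the simple permutations of size `n` in `Av(B)`. -/
def ListsSimple (B : Set (Σ n : ℕ, Equiv.Perm (Fin n))) {n : ℕ} (l : List (Equiv.Perm (Fin n))) :
    Prop :=
  ∀ σ, σ ∈ l ↔ IsSimple σ ∧ ⟨n, σ⟩ ∈ Av B

theorem mem_av_of_insertPoint (hsimple : ∀ β ∈ B, IsSimple β.2) (h4 : ∀ β ∈ B, 4 ≤ β.1) {m : ℕ}
    (hm : 3 ≤ m) {prev : List (Equiv.Perm (Fin (m + 1)))} (hprev : ListsSimple B prev)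
    {π : Equiv.Perm (Fin (m + 1))} (hπ : π ∈ prev) {i v : Fin (m + 2)}
    (hs : IsSimple (insertPoint π i v)) (hB : ⟨m + 2, insertPoint π i v⟩ ∉ B)
    (hd : DeletionsIn prev (insertPoint π i v)) : ⟨m + 2, insertPoint π i v⟩ ∈ Av B := by
  set ρ := insertPoint π i v with hρ
  refine ⟨by simp, fun β hβ h => ?_⟩
  -- The simple `π` of size `m + 1` would have to fit into the exceptional permutation of size `m`.
  have hexc : ∀ t, ¬ IsExceptional t ρ := by
    rintro t ⟨-, hpar, he⟩
    have h1 : IsPattern π (exceptional t (m + 2)) := by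
      rw [← he, ← deletePoint_insertPoint i π v]
      exact isPattern_deletePoint ρ i
    have := (isPattern_exceptional t (by omega) ((hprev π).1 hπ).1 (by omega) (by omega) h1).le
    omega
  obtain ⟨x, hx, g, hg, hgx⟩ := exists_simpleOn_compl_singleton (isSimple_iff.1 hs).2
    (isSimple_iff.1 (hsimple β hβ)).2 h (h4 β hβ) (lt_of_isPattern_of_notMem hB hβ h) hexc
  have h1 := hd x ((isSimple_deletePoint_iff (by omega)).2 hx)
  exact ((hprev _).1 h1).2.2 β hβ (hg.isPattern_deletePoint hgx)

theorem mem_av_exceptional (hsimple : ∀ β ∈ B, IsSimple β.2) (h4 : ∀ β ∈ B, 4 ≤ β.1) {m : ℕ}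
    {t : ExcType} (h : m % 2 = 0) (hB : ⟨m + 2, exceptional t (m + 2)⟩ ∉ B)
    (hπ : ⟨m, exceptional t m⟩ ∈ Av B) : ⟨m + 2, exceptional t (m + 2)⟩ ∈ Av B :=
  ⟨by simp, fun β hβ hp => hπ.2 β hβ (isPattern_exceptional t h (hsimple β hβ)
    (by have := h4 β hβ; omega) (lt_of_isPattern_of_notMem hB hβ hp) hp)⟩

/-- Completeness of one pass. Applied to empty lists, it also shows that nothing follows two
consecutive empty sets. -/
theorem exists_insertPoint_or_exceptional {m : ℕ} (hm : 3 ≤ m)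
    {prev : List (Equiv.Perm (Fin (m + 1)))} (hprev : ListsSimple B prev)
    {prev₂ : List (Equiv.Perm (Fin m))} (hprev₂ : ListsSimple B prev₂)
    {ρ : Equiv.Perm (Fin (m + 2))} (hs : IsSimple ρ) (hρ : ⟨m + 2, ρ⟩ ∈ Av B) :
    (∃ π ∈ prev, ∃ i v, ρ = insertPoint π i v) ∨
      ∃ π ∈ prev₂, ∃ t, IsExceptional t π ∧ ρ = exceptional t (m + 2) := by
  by_cases hexc : ∃ t, IsExceptional t ρ
  · right
    obtain ⟨t, -, hpar, rfl⟩ := hexc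
    have hpar' : m % 2 = 0 := by omega
    have hm' : 4 ≤ m := by omega
    refine ⟨exceptional t m, (hprev₂ _).2 ⟨exceptional_isSimple t hm' hpar',
      mem_av_of_isPattern hρ (isPattern_exceptional_exceptional t hpar') (by omega)⟩, t,
      ⟨hm', hpar', rfl⟩, rfl⟩
  · left
    push Not at hexc
    obtain ⟨i, hi⟩ := exists_isSimple_deletePoint (by omega) hs hexc
    exact ⟨deletePoint ρ i, (hprev _).2 ⟨hi, mem_av_of_isPattern hρ (isPattern_deletePoint ρ i)
      (by omega)⟩, i, ρ i, (insertPoint_deletePoint ρ i).symm⟩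

/-- The body of the loop computes the next set from the two preceding ones. -/
theorem listsSimple_loopBody (hsimple : ∀ β ∈ B, IsSimple β.2) (h4 : ∀ β ∈ B, 4 ≤ β.1) {m : ℕ}
    (hm : 3 ≤ m) {prev : List (Equiv.Perm (Fin (m + 1)))} (hprev : ListsSimple B prev)
    {prev₂ : List (Equiv.Perm (Fin m))} (hprev₂ : ListsSimple B prev₂) :
    ListsSimple B ((exceptionalPhase prev₂ ((insertionPhase prev []).run B).1).run B).1 := by
  intro ρ
  rw [mem_run_exceptionalPhase, mem_run_insertionPhase]
  constructor
  · rintro ((h | ⟨π, hπ, i, v, rfl, hs, hB, hd⟩) | ⟨π, hπ, t, ⟨h1, h2, rfl⟩, rfl, hB⟩)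
    · simp at h
    · exact ⟨hs, mem_av_of_insertPoint hsimple h4 hm hprev hπ hs hB hd⟩
    · exact ⟨exceptional_isSimple t (by omega) (by omega),
        mem_av_exceptional hsimple h4 h2 hB ((hprev₂ _).1 hπ).2⟩
  · rintro ⟨hs, hρ⟩
    have hB := notMem_basis_of_mem_av hρ
    rcases exists_insertPoint_or_exceptional hm hprev hprev₂ hs hρ with
      ⟨π, hπ, i, v, h⟩ | ⟨π, hπ, t, ht, h⟩
    · refine Or.inl (Or.inr ⟨π, hπ, i, v, h, hs, hB, fun j hj => (hprev _).2 ⟨hj, ?_⟩⟩)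
      exact mem_av_of_isPattern hρ (isPattern_deletePoint ρ j) (by omega)
    · exact Or.inr ⟨π, hπ, t, ht, h, hB⟩

theorem mem_av_of_lt (h4 : ∀ β ∈ B, 4 ≤ β.1) {n : ℕ} (hn : 1 ≤ n) (hn' : n < 4)
    (σ : Equiv.Perm (Fin n)) : ⟨n, σ⟩ ∈ Av B :=
  ⟨hn, fun β hβ h => by have := h4 β hβ; have := IsPattern.le h; simp only at this; omega⟩

theorem isSimple_four_iff {σ : Equiv.Perm (Fin 4)} :
    IsSimple σ ↔ σ = perm2413 ∨ σ = perm3142 := by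
  constructor
  · intro h
    exact (isPattern_four_of_simpleOn (isSimple_iff.1 h).2 (by omega)).imp
      (fun h => h.eq.symm) fun h => h.eq.symm
  · rintro (rfl | rfl)
    exacts [isSimple_perm2413, isSimple_perm3142]

/-- The sets of size less than the counter of the state are correct. -/
def State.IsCorrect (B : Set (Σ n : ℕ, Equiv.Perm (Fin n))) (s : State) : Prop :=
  3 ≤ s.m ∧ ∀ n, 1 ≤ n → n < s.m + 2 → ListsSimple B (s.Si n)

theorem mem_run_initial (σ : Equiv.Perm (Fin 4)) :
    σ ∈ (([perm2413, perm3142].foldlM (init := []) fun S σ => do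
      if ← test (.memBasis σ) then pure S else pure (S.insert σ) : Prog _).run B).1 ↔
      (σ = perm2413 ∨ σ = perm3142) ∧ ⟨4, σ⟩ ∉ B := by
  classical
  rw [run_foldlM, foldl_iff_or (P := fun S => σ ∈ S) (Q := fun τ => σ = τ ∧ ⟨4, σ⟩ ∉ B)]
  · simp only [List.not_mem_nil, false_or, List.mem_cons, or_false]
    constructor
    · rintro ⟨τ, h, rfl, h'⟩
      exact ⟨h, h'⟩
    · exact fun h => ⟨σ, h.1, rfl, h.2⟩
  · intro S τ
    by_cases h : (⟨4, τ⟩ : Σ n : ℕ, Equiv.Perm (Fin n)) ∈ B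
    · rw [run_test_ite_of_holds (t := .memBasis _) h, Prog.run_pure]
      refine ⟨Or.inl, fun hor => hor.resolve_right ?_⟩
      rintro ⟨rfl, hnot⟩
      exact hnot h
    · rw [run_test_ite_of_not_holds (t := .memBasis _) h, Prog.run_pure, List.mem_insert_iff, or_comm]
      refine or_congr_right ⟨?_, fun h => h.1⟩
      rintro rfl
      exact ⟨rfl, h⟩

theorem isCorrect_initialState (h4 : ∀ β ∈ B, 4 ≤ β.1) :
    State.IsCorrect B (initialState.run B).1 := by
  rw [initialState, Prog.run_bind, Prog.run_pure]
  refine ⟨le_rfl, fun n hn hn' => ?_⟩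
  simp only at hn'
  match n, hn, hn' with
  | 1, _, _ =>
    intro σ
    refine iff_of_true (List.mem_singleton.2 (Subsingleton.elim _ _)) ⟨⟨le_rfl, fun a b _ => ?_⟩,
      mem_av_of_lt h4 le_rfl (by omega) σ⟩
    exact Or.inl (Subsingleton.elim _ _)
  | 2, _, _ =>
    intro σ
    have : ∀ σ : Equiv.Perm (Fin 2), σ ∈ [perm12, perm21] := by decide
    exact iff_of_true (this σ) ⟨isSimple_perm_two σ, mem_av_of_lt h4 (by omega) (by omega) σ⟩
  | 3, _, _ =>
    intro σ
    refine iff_of_false (List.not_mem_nil) fun h => ?_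
    have := four_le_of_simpleOn (isSimple_iff.1 h.1).2 le_rfl
    omega
  | 4, _, _ =>
    intro σ
    refine (mem_run_initial σ).trans ?_
    rw [← isSimple_four_iff]
    -- Elements of `B` have size at least 4, so none is a proper pattern in size 4.
    refine and_congr_right fun _ => ⟨fun h => ⟨by simp, fun β hβ hp => ?_⟩, notMem_basis_of_mem_av⟩
    have := h4 β hβ
    have := lt_of_isPattern_of_notMem h hβ hp
    omega

theorem isCorrect_loopBody (hsimple : ∀ β ∈ B, IsSimple β.2) (h4 : ∀ β ∈ B, 4 ≤ β.1) {s : State}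
    (hs : s.IsCorrect B) : State.IsCorrect B ((loopBody s).run B).1 := by
  rw [loopBody, Prog.run_bind, Prog.run_bind, Prog.run_pure]
  obtain ⟨hm, hs⟩ := hs
  refine ⟨by simp only; omega, fun n hn hn' => ?_⟩
  simp only at hn' ⊢
  by_cases h : n = s.m + 2
  · subst h
    rw [Function.update_self]
    exact listsSimple_loopBody hsimple h4 hm (hs _ (by omega) (by omega))
      (hs _ (by omega) (by omega))
  · rw [Function.update_of_ne h]
    exact hs n hn (by omega)

theorem loopBody_m (s : State) : ((loopBody s).run B).1.m = s.m + 1 := by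
  rw [loopBody, Prog.run_bind, Prog.run_bind, Prog.run_pure]

theorem stateAfter_succ (k : ℕ) : stateAfter B (k + 1) =
    if (stateAfter B k).loopCondition then ((loopBody (stateAfter B k)).run B).1
      else stateAfter B k := by
  have : stateAfter B (k + 1) = ((if (stateAfter B k).loopCondition then
      loopBody (stateAfter B k) else pure (stateAfter B k) : Prog State).run B).1 := by
    rw [stateAfter, algorithm, Prog.run_bind]
    rfl
  rw [this]
  split_ifs <;> rfl

theorem isCorrect_stateAfter (hsimple : ∀ β ∈ B, IsSimple β.2) (h4 : ∀ β ∈ B, 4 ≤ β.1) (k : ℕ) :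
    (stateAfter B k).IsCorrect B := by
  induction k with
  | zero => exact isCorrect_initialState h4
  | succ k ih =>
    rw [stateAfter_succ]
    split_ifs
    · exact isCorrect_loopBody hsimple h4 ih
    · exact ih

theorem stateAfter_m (h : ∀ k, (stateAfter B k).loopCondition) (k : ℕ) :
    (stateAfter B k).m = k + 3 := by
  induction k with
  | zero => rw [stateAfter, algorithm, initialState, Prog.run_bind, Prog.run_pure]
  | succ k ih => rw [stateAfter_succ, if_pos (h k), loopBody_m, ih, Nat.add_right_comm]

/-- Two consecutive empty sets are followed by empty sets only. -/
theorem no_simple_of_not_loopCondition {s : State} (hs : s.IsCorrect B)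
    (h : ¬ s.loopCondition) (n : ℕ) (hn : s.m ≤ n) (σ : Equiv.Perm (Fin n)) :
    ¬ (IsSimple σ ∧ ⟨n, σ⟩ ∈ Av B) := by
  obtain ⟨hm, hs⟩ := hs
  simp only [State.loopCondition, not_or, not_not] at h
  induction n using Nat.strong_induction_on with
  | _ n ih =>
    by_cases h0 : n = s.m
    · subst h0
      rw [← hs _ (by omega) (by omega) σ, h.2]
      exact List.not_mem_nil
    by_cases h1 : n = s.m + 1
    · subst h1
      rw [← hs _ (by omega) (by omega) σ, h.1]
      exact List.not_mem_nil
    obtain ⟨l, rfl⟩ : ∃ l, n = l + 2 := ⟨n - 2, by omega⟩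
    have key : ∀ j, s.m ≤ j → j < l + 2 → ListsSimple B ([] : List (Equiv.Perm (Fin j))) :=
      fun j hj hj' τ => iff_of_false List.not_mem_nil (ih j hj' hj τ)
    rintro ⟨hσ, hσB⟩
    rcases exists_insertPoint_or_exceptional (by omega) (key (l + 1) (by omega) (by omega))
      (key l (by omega) (by omega)) hσ hσB with ⟨π, hπ, -⟩ | ⟨π, hπ, -⟩ <;>
    exact List.not_mem_nil hπ

end Correctness

end SimplePerm

/-! ### The main theorem -/

theorem mainTheorem5 (B : Set (Σ n : ℕ, Equiv.Perm (Fin n))) (hfin : B.Finite)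
    (hsimple : ∀ β ∈ B, SimplePerm.IsSimple β.2)
    (h1 : ⟨1, 1⟩ ∉ B) (h12 : ⟨2, SimplePerm.perm12⟩ ∉ B) (h21 : ⟨2, SimplePerm.perm21⟩ ∉ B) :
    -- every computed set `Si n` is the set of simple permutations of size `n` in `Av(B)`
    (∀ passes n : ℕ, 1 ≤ n → n < (SimplePerm.stateAfter B passes).n →
      ∀ σ : Equiv.Perm (Fin n), σ ∈ (SimplePerm.stateAfter B passes).Si n ↔
        SimplePerm.IsSimple σ ∧ ⟨n, σ⟩ ∈ SimplePerm.Av B) ∧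
    -- every `Si n` gets computed, unless the algorithm terminates before and the set is empty
    (∀ n : ℕ, 1 ≤ n →
      (∃ passes : ℕ, n < (SimplePerm.stateAfter B passes).n) ∨
      ((∃ passes : ℕ, ¬ (SimplePerm.stateAfter B passes).loopCondition) ∧
        ∀ σ : Equiv.Perm (Fin n), ¬ (SimplePerm.IsSimple σ ∧ ⟨n, σ⟩ ∈ SimplePerm.Av B))) ∧
    -- no pattern-involvement test is ever asked
    (∀ passes : ℕ, ∀ t ∈ SimplePerm.testsAsked B passes, ¬ t.IsInvolvement) := by
  have h4 := SimplePerm.four_le_of_mem_basis hsimple h1 h12 h21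
  have hcorrect := SimplePerm.isCorrect_stateAfter hsimple h4
  refine ⟨fun k n hn hnk => (hcorrect k).2 n hn hnk, fun n hn => ?_,
    SimplePerm.asksNoInvolvement_algorithm B⟩
  by_cases h : ∃ k, ¬ (SimplePerm.stateAfter B k).loopCondition
  · obtain ⟨k, hk⟩ := h
    by_cases hnk : n < (SimplePerm.stateAfter B k).n
    · exact Or.inl ⟨k, hnk⟩
    · refine Or.inr ⟨⟨k, hk⟩, SimplePerm.no_simple_of_not_loopCondition (hcorrect k) hk n ?_⟩
      rw [SimplePerm.State.n] at hnk
      omega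
  · push Not at h
    -- If the loop never stops, the counter is `n + 5` after `n` passes.
    refine Or.inl ⟨n, ?_⟩
    rw [SimplePerm.State.n, SimplePerm.stateAfter_m h]
    omega
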